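/- Let $p$ be a prime, $S$ a finite $p$-group and $\mathcal F$ a saturated fusion system over $S$. Write ${}^{x}a=xax^{-1}$, $A^{h}=h^{-1}Ah$, let $c_h\colon A^h\to A$ be the map $x\mapsto hxh^{-1}$ and $\iota$ inclusions. Let $\mathcal O(\mathcal F)$ be the orbit category: $\operatorname{Hom}_{\mathcal O(\mathcal F)}(A,K)$ is the set of classes $\overline\varphi$ of $\varphi\in\operatorname{Hom}_{\mathcal F}(A,K)$ modulo conjugation by elements of $K$. A subgroup $A\le S$ is $\mathcal F$-centric if $C_S(B)\le B$ for every $B$ isomorphic to $A$ in $\mathcal F$. **The sets $[H\times_{\mathcal F}K]$.** Let $H,K$ be $\mathcal F$-centric. Consider the pairs $(A,\overline\varphi)$ with $A\le H$ an $\mathcal F$-centric subgroup and $\overline\varphi\in\operatorname{Hom}_{\mathcal O(\mathcal F)}(A,K)$, preordered by: $(A,\overline\varphi)\precsim_H(B,\overline\psi)$ iff there is $h\in H$ with $A^h\le B$ and $\overline\varphi\,\overline{c_h}=\overline\psi\,\overline{\iota_{A^h}^{B}}$. A choice of $[H\times_{\mathcal F}K]$ is a set containing exactly one representative of each class of maximal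 pairs, where two maximal pairs are equivalent if each is $\precsim_H$ the other. **Normalizers.** Fix a fully $\mathcal F$-normalized $\mathcal F$-centric $H\le S$. Let $N_S=N_S(H)$ and let $N_{\mathcal F}=N_{\mathcal F}(H)$ be the fusion system over $N_S$ whose morphisms $A\to B$ are the $\varphi\in\operatorname{Hom}_{\mathcal F}(A,B)$ that extend to some $\psi\in\operatorname{Hom}_{\mathcal F}(AH,BH)$ with $\psi(H)=H$. For $\varphi\in\operatorname{Hom}_{\mathcal F}(A,K)$ with $A\le N_S$ put $$ {}^{N_{\mathcal F}}_{\ \ \varphi}N=\{x\in N_K(\varphi(A)) : \varphi^{-1}c_x\varphi\in\operatorname{Aut}_{N_{\mathcal F}}(A)\},$$ $$ N_\varphi^{N_{\mathcal F}}=\{x\in N_{N_S}(A) : \varphi c_x\varphi^{-1}\in \operatorname{Aut}_{{}^{N_{\mathcal F}}_{\ \ \varphi}N}(\varphi(A))\},$$ where $\varphi$ is viewed as an isomorphism onto $\varphi(A)$. The group $N_{\overline\varphi}^{N_{\mathcal F}}:=N_\varphi^{N_{\mathcal F}}$, the normalizer before $\overline\varphi$ in $N_{\mathcal F}$, depends only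 on $\overline\varphi$. Write $\overline\varphi=\overline\varphi^{N_{\mathcal F}}$ if $A$ is fully $N_{\mathcal F}$-normalized and, for some representative $\varphi$, $\operatorname{Aut}_{{}^{N_{\mathcal F}}_{\ \ \varphi}N}(\varphi(A))=\varphi\operatorname{Aut}_{N_\varphi^{N_{\mathcal F}}}(A)\varphi^{-1}$. Given a choice of $[H\times_{\mathcal F}K]$, call two of its elements $(A,\overline\varphi)$, $(B,\overline\psi)$ equivalent if $\overline\varphi=\overline\psi\,\overline\theta$ for some isomorphism $\theta\colon A\to B$ in $N_{\mathcal F}$. A choice of $[N_{\mathcal F}\times K]$ is a subset of $[H\times_{\mathcal F}K]$ containing exactly one element of each equivalence class and all of whose elements $(A,\overline\varphi)$ have $A$ fully $N_{\mathcal F}$-normalized and $\overline\varphi=\overline\varphi^{N_{\mathcal F}}$. **Theorem.** Let $K$ be $\mathcal F$-centric, fix a choice of $[H\times_{\mathcal F}K]$ and a choice of $[N_{\mathcal F}\times K]\subseteq[H\times_{\mathcal F}K]$. Then for every $(A,\overline\varphi)\in[N_{\mathcal F}\times K]$ we have $A\le N_{\overline\varphi}^{N_{\mathcal F}}$ and there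 is a unique $\overline{\hat\varphi}\in\operatorname{Hom}_{\mathcal O(\mathcal F)}(N_{\overline\varphi}^{N_{\mathcal F}},K)$ with $\overline{\hat\varphi}\,\overline{\iota_A}=\overline\varphi$. Moreover $H$ and the groups $N_{\overline\varphi}^{N_{\mathcal F}}$ are $N_{\mathcal F}$-centric, and for every $(A,\overline\varphi)\in[N_{\mathcal F}\times K]$ one can choose $[H\times_{N_{\mathcal F}}N_{\overline\varphi}^{N_{\mathcal F}}]$ so that $$[H\times_{\mathcal F}K]=\bigsqcup_{(A,\overline\varphi)\in[N_{\mathcal F}\times K]}\ \overline{\hat\varphi}\,[H\times_{N_{\mathcal F}}N_{\overline\varphi}^{N_{\mathcal F}}],\qquad \overline{\hat\varphi}\,[H\times_{N_{\mathcal F}}N_{\overline\varphi}^{N_{\mathcal F}}]:=\bigsqcup_{(B,\overline\psi)\in[H\times_{N_{\mathcal F}}N_{\overline\varphi}^{N_{\mathcal F}}]}\{(B,\overline{\hat\varphi}\,\overline\psi)\},$$ all unions being disjoint. -/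

import Mathlib

noncomputable section

open Subgroup

/-! Throughout, all groups under consideration are subgroups of an ambient group `G`
(one may take `G = S`, `S = ⊤`).  A morphism `A → B` is a group homomorphism `A →* B` between
the groups underlying two subgroups, and composition is composition of functions. -/

namespace Fus

variable {G : Type*} [Group G]

/-- The image `φ(A)`, as a subgroup of the ambient group. -/
def image {A B : Subgroup G} (φ : A →* B) : Subgroup G := (B.subtype.comp φ).range

lemma injective_val {A B : Subgroup G} {φ : A →* B} (h : Function.Injective φ) :
    Function.Injective (B.subtype.comp φ) :=
  Subtype.val_injective.comp h

/-- An injective `φ : A → B` viewed as an isomorphism `A ≃ φ(A)` onto its image. -/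
def toImage {A B : Subgroup G} (φ : A →* B) (h : Function.Injective φ) : A ≃* image φ :=
  MonoidHom.ofInjective (injective_val h)

/-- A (not necessarily saturated) fusion system over `S`: the category with objects the
subgroups of `S` and morphism sets `Hom A B`. -/
structure FusionSystem (S : Subgroup G) where
  /-- the set of morphisms from `A` to `B` -/
  Hom : (A B : Subgroup G) → Set (A →* B)
  source_le : ∀ {A B : Subgroup G} {φ : A →* B}, φ ∈ Hom A B → A ≤ S
  target_le : ∀ {A B : Subgroup G} {φ : A →* B}, φ ∈ Hom A B → B ≤ S
  injective : ∀ {A B : Subgroup G} {φ : A →* B}, φ ∈ Hom A B → Function.Injective φ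
  comp_mem : ∀ {A B C : Subgroup G} {ψ : B →* C} {φ : A →* B},
    ψ ∈ Hom B C → φ ∈ Hom A B → ψ.comp φ ∈ Hom A C
  /-- every morphism given by conjugation by an element of `S` is in the system -/
  conj_mem : ∀ {A B : Subgroup G}, A ≤ S → B ≤ S → ∀ x ∈ S, ∀ φ : A →* B,
    (∀ a : A, (φ a : G) = x * a * x⁻¹) → φ ∈ Hom A B
  toImage_mem : ∀ {A B : Subgroup G} {φ : A →* B} (h : φ ∈ Hom A B),
    (toImage φ (injective h)).toMonoidHom ∈ Hom A (image φ)
  toImage_symm_mem : ∀ {A B : Subgroup G} {φ : A →* B} (h : φ ∈ Hom A B),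
    (toImage φ (injective h)).symm.toMonoidHom ∈ Hom (image φ) A

/-- `Aut_L(A)`: the automorphisms of `A` given by conjugation by an element of `L`. -/
def autBy (L A : Subgroup G) : Subgroup (MulAut A) where
  carrier := {α | ∃ x ∈ L, ∀ a : A, (α a : G) = x * a * x⁻¹}
  one_mem' := ⟨1, L.one_mem, fun a => by simp⟩
  mul_mem' := by
    rintro α β ⟨x, hx, h⟩ ⟨y, hy, k⟩
    exact ⟨x * y, L.mul_mem hx hy, fun a => by simp [h, k, mul_assoc]⟩
  inv_mem' := by
    rintro α ⟨x, hx, h⟩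
    refine ⟨x⁻¹, L.inv_mem hx, fun a => ?_⟩
    have := h (α⁻¹ a)
    rw [MulAut.apply_inv_self] at this
    rw [this]; group

/-- For `φ : A → K` and a subgroup `L`: the group of all `x ∈ N_T(A)` for which there is `y ∈ L`
with `φ(x a x⁻¹) = y φ(a) y⁻¹` for all `a ∈ A`. -/
def conjLift (T L : Subgroup G) {A K : Subgroup G} (φ : A →* K) : Subgroup G where
  carrier := {x | x ∈ T ⊓ normalizer (A : Set G) ∧
    ∃ y ∈ L, ∀ a b : A, (b : G) = x * a * x⁻¹ → (φ b : G) = y * φ a * y⁻¹}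
  one_mem' := ⟨one_mem _, 1, one_mem _, fun a b h => by
    have : b = a := Subtype.ext (by simpa using h)
    simp [this]⟩
  mul_mem' := by
    rintro x x' ⟨hx, y, hy, h⟩ ⟨hx', y', hy', h'⟩
    refine ⟨mul_mem hx hx', y * y', mul_mem hy hy', fun a b hb => ?_⟩
    have hc : x' * (a : G) * x'⁻¹ ∈ A := (mem_normalizer_iff.1 hx'.2 _).1 a.2
    rw [h ⟨_, hc⟩ b (by simp [hb, mul_assoc]), h' a ⟨_, hc⟩ rfl]
    simp [mul_assoc]
  inv_mem' := by
    rintro x ⟨hx, y, hy, h⟩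
    refine ⟨inv_mem hx, y⁻¹, inv_mem hy, fun a b hb => ?_⟩
    rw [h b a (by simp [hb, mul_assoc])]
    simp [mul_assoc]

namespace FusionSystem

variable {S : Subgroup G}

/-- `Aut_F(A)`, for an object `A ≤ S` (the only case in which it is used). -/
def aut (F : FusionSystem S) (A : Subgroup G) : Subgroup (MulAut A) where
  carrier := {α | A ≤ S → α.toMonoidHom ∈ F.Hom A A}
  one_mem' := fun hA => F.conj_mem hA hA 1 S.one_mem _ (fun a => by simp)
  mul_mem' := fun {_ _} h k hA => F.comp_mem (h hA) (k hA)
  inv_mem' := by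
    intro α h hA
    have h1 := F.toImage_symm_mem (h hA)
    have h2 : α⁻¹.toMonoidHom = (toImage _ (F.injective (h hA))).symm.toMonoidHom.comp
        (Subgroup.inclusion (show A ≤ image α.toMonoidHom from fun a ha =>
          ⟨α⁻¹ ⟨a, ha⟩, by simp⟩)) := by
      ext1 a
      exact (MulEquiv.eq_symm_apply (toImage α.toMonoidHom (F.injective (h hA)))).2 (Subtype.ext
        (show ((α (α⁻¹ a) : A) : G) = a from by rw [MulAut.apply_inv_self]))
    have h3 := F.comp_mem h1 (F.conj_mem hA (F.source_le h1) 1 S.one_mem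
      (Subgroup.inclusion (show A ≤ image α.toMonoidHom from fun a ha =>
          ⟨α⁻¹ ⟨a, ha⟩, by simp⟩)) (fun a => by rw [Subgroup.coe_inclusion]; simp))
    rw [← h2] at h3
    exact h3

/-- `A` and `B` are isomorphic in `F`. -/
def IsoIn (F : FusionSystem S) (A B : Subgroup G) : Prop :=
  ∃ φ ∈ F.Hom A B, Function.Surjective φ

/-- `A` is fully `F`-normalized. -/
def IsFullyNormalized (F : FusionSystem S) (A : Subgroup G) : Prop :=
  A ≤ S ∧ ∀ B : Subgroup G, F.IsoIn A B →
    Nat.card ↥(S ⊓ normalizer (B : Set G)) ≤ Nat.card ↥(S ⊓ normalizer (A : Set G))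

/-- `A` is `F`-centric. -/
def IsCentric (F : FusionSystem S) (A : Subgroup G) : Prop :=
  A ≤ S ∧ ∀ B : Subgroup G, F.IsoIn A B → S ⊓ centralizer (B : Set G) ≤ B

/-- `F` is saturated: `Aut_S(S)` is a Sylow `p`-subgroup of `Aut_F(S)`, and every `φ : A → S`
with fully normalized image extends to the `φ`-normalizer
`N_φ = {x ∈ N_S(A) | ∃ z ∈ N_S(φ(A)), ∀ a ∈ A, φ(x a x⁻¹) = z φ(a) z⁻¹}`. -/
def IsSaturated (F : FusionSystem S) (p : ℕ) : Prop :=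
  (∃ P : Sylow p (F.aut S), (P : Subgroup (F.aut S)).map (F.aut S).subtype = autBy S S) ∧
  ∀ (A : Subgroup G) (φ : A →* S), φ ∈ F.Hom A S → F.IsFullyNormalized (image φ) →
    ∃ ψ ∈ F.Hom (conjLift S (S ⊓ normalizer (image φ : Set G)) φ) S,
      ∀ (a : A) (n : conjLift S (S ⊓ normalizer (image φ : Set G)) φ),
        (n : G) = a → ψ n = φ a

/-! ### The orbit category -/

/-- Two morphisms `A → K` are identified if they differ by a conjugation by an element of `K`. -/
def orbitSetoid (F : FusionSystem S) (A K : Subgroup G) : Setoid (F.Hom A K) where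
  r φ ψ := ∃ k : K, ∀ a : A, ψ.1 a = k * φ.1 a * k⁻¹
  iseqv :=
    { refl := fun φ => ⟨1, fun a => by simp⟩
      symm := by
        rintro φ ψ ⟨k, h⟩
        exact ⟨k⁻¹, fun a => by rw [h]; group⟩
      trans := by
        rintro φ ψ χ ⟨k, h⟩ ⟨l, h'⟩
        exact ⟨l * k, fun a => by rw [h', h]; group⟩ }

/-- The morphisms `A → K` of the orbit category `O(F)`. -/
def OrbHom (F : FusionSystem S) (A K : Subgroup G) : Type _ := Quotient (F.orbitSetoid A K)

/-- The class in the orbit category of a morphism. -/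
def cls (F : FusionSystem S) {A K : Subgroup G} (φ : F.Hom A K) : F.OrbHom A K :=
  Quotient.mk (F.orbitSetoid A K) φ

namespace OrbHom

variable {F : FusionSystem S} {A B K : Subgroup G}

lemma source_le (f : F.OrbHom A K) : A ≤ S :=
  Quotient.inductionOn f fun φ => F.source_le φ.2

lemma target_le (f : F.OrbHom A K) : K ≤ S :=
  Quotient.inductionOn f fun φ => F.target_le φ.2

/-- Composition in the orbit category: `g.comp f` is `g ∘ f`. -/
def comp (g : F.OrbHom B K) (f : F.OrbHom A B) : F.OrbHom A K :=
  Quotient.map₂ (fun (ψ : F.Hom B K) (φ : F.Hom A B) => ⟨ψ.1.comp φ.1, F.comp_mem ψ.2 φ.2⟩)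
    (by
      rintro ψ ψ' ⟨k, hk⟩ φ φ' ⟨b, hb⟩
      exact ⟨k * ψ.1 b, fun a => by simp [hk, hb, mul_assoc]⟩) g f

end OrbHom

/-- The class of the inclusion `A → B`. -/
def inclCls (F : FusionSystem S) {A B : Subgroup G} (h : A ≤ B) (hB : B ≤ S) : F.OrbHom A B :=
  F.cls ⟨Subgroup.inclusion h,
    F.conj_mem (h.trans hB) hB 1 S.one_mem _ (fun a => by simp)⟩

/-- `A^h = h⁻¹ A h`. -/
def conjSubgroup (A : Subgroup G) (h : G) : Subgroup G := A.map (MulAut.conj h⁻¹).toMonoidHom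

lemma conj_mem_of_mem_conjSubgroup {A : Subgroup G} {h x : G} (hx : x ∈ conjSubgroup A h) :
    h * x * h⁻¹ ∈ A := by
  obtain ⟨a, ha, rfl⟩ := hx
  simpa [mul_assoc] using ha

/-- The conjugation homomorphism `c_h : A^h → A`, `x ↦ h x h⁻¹`. -/
def conjHom (A : Subgroup G) (h : G) : conjSubgroup A h →* A where
  toFun x := ⟨h * x * h⁻¹, conj_mem_of_mem_conjSubgroup x.2⟩
  map_one' := by simp
  map_mul' x y := by apply Subtype.ext; simp [mul_assoc]

/-- The class of `c_h : A^h → A` for `h ∈ S`. -/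
def conjCls (F : FusionSystem S) {A : Subgroup G} {h : G} (hA : A ≤ S) (hh : h ∈ S) :
    F.OrbHom (conjSubgroup A h) A :=
  F.cls ⟨conjHom A h, F.conj_mem (by
    rintro x ⟨a, ha, rfl⟩
    exact S.mul_mem (S.mul_mem (S.inv_mem hh) (hA ha)) (S.inv_mem (S.inv_mem hh)))
    hA h hh _ (fun _ => rfl)⟩

/-! ### The sets `[H ×_F K]` -/

/-- A pair `(A, f)` with `f : A → K` a morphism of the orbit category. -/
abbrev Pair (F : FusionSystem S) (K : Subgroup G) := Σ A : Subgroup G, F.OrbHom A K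

/-- The pairs `(A, f)` over `H` and `K`: those with `A` an `F`-centric subgroup of `H`. -/
def IsPair (F : FusionSystem S) (H K : Subgroup G) (x : F.Pair K) : Prop :=
  x.1 ≤ H ∧ F.IsCentric x.1

/-- `(A, f) ≾_H (B, g)`: there is `h ∈ H` with `A^h ≤ B` and `f ∘ c_h = g ∘ ι` on `A^h`. -/
def PairLE (F : FusionSystem S) {H : Subgroup G} (hH : H ≤ S) {K : Subgroup G}
    (x y : F.Pair K) : Prop :=
  ∃ (h : G) (hh : h ∈ H) (hle : conjSubgroup x.1 h ≤ y.1),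
    x.2.comp (F.conjCls x.2.source_le (hH hh)) = y.2.comp (F.inclCls hle y.2.source_le)

/-- A pair over `H` and `K` which is maximal for the preorder `≾_H`. -/
def IsMaximalPair (F : FusionSystem S) {H : Subgroup G} (hH : H ≤ S) (K : Subgroup G)
    (x : F.Pair K) : Prop :=
  F.IsPair H K x ∧ ∀ y, F.IsPair H K y → F.PairLE hH x y → F.PairLE hH y x

/-- `P` is a choice of `[H ×_F K]` (for `F`-centric `H` and `K`): a set containing exactly one
representative of each class of maximal pairs. -/
def IsProductReps (F : FusionSystem S) {H : Subgroup G} (hH : H ≤ S) (K : Subgroup G)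
    (P : Set (F.Pair K)) : Prop :=
  F.IsCentric H ∧ F.IsCentric K ∧
  (∀ x ∈ P, F.IsMaximalPair hH K x) ∧
  ∀ x, F.IsMaximalPair hH K x → ∃! y, y ∈ P ∧ F.PairLE hH x y ∧ F.PairLE hH y x

/-! ### The normalizer fusion system -/

lemma image_eq_of_val {A B A' B' : Subgroup G} {φ : A →* B} {φ' : A' →* B'} (hA : A = A')
    (h : ∀ (a : A) (a' : A'), (a : G) = a' → (φ a : G) = φ' a') : image φ = image φ' := by
  subst hA
  ext x
  constructor
  · rintro ⟨a, rfl⟩; exact ⟨a, (h a a rfl).symm⟩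
  · rintro ⟨a, rfl⟩; exact ⟨a, h a a rfl⟩

/-- Membership in `F` depends only on the underlying function. -/
lemma mem_of_val (F : FusionSystem S) {A B A' B' : Subgroup G} {φ : A →* B} {φ' : A' →* B'}
    (hφ : φ ∈ F.Hom A B) (hA : A = A') (hB : B' ≤ S)
    (h : ∀ (a : A) (a' : A'), (a : G) = a' → (φ a : G) = φ' a') : φ' ∈ F.Hom A' B' := by
  subst hA
  have hle : image φ ≤ B' := by
    rintro x ⟨a, rfl⟩
    have : (B.subtype.comp φ) a = (φ' a : G) := h a a rfl
    rw [this]; exact (φ' a).2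
  have h1 := F.toImage_mem hφ
  have h2 : Subgroup.inclusion hle ∈ F.Hom (image φ) B' :=
    F.conj_mem (F.target_le h1) hB 1 S.one_mem _ (fun a => by simp)
  have h3 : φ' = (Subgroup.inclusion hle).comp (toImage φ (F.injective hφ)).toMonoidHom := by
    ext a
    exact (h a a rfl).symm
  rw [h3]
  exact F.comp_mem h2 h1

/-- `ψ : A H → B H` is an extension of `φ : A → B` which maps `H` onto `H`. -/
def NormExt (F : FusionSystem S) (H : Subgroup G) {A B : Subgroup G} (φ : A →* B)
    (ψ : ↥(A ⊔ H) →* ↥(B ⊔ H)) : Prop :=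
  ψ ∈ F.Hom (A ⊔ H) (B ⊔ H) ∧
  (∀ (a : A) (x : ↥(A ⊔ H)), (x : G) = a → (ψ x : G) = φ a) ∧
  ∀ y : G, y ∈ H ↔ ∃ x : ↥(A ⊔ H), (x : G) ∈ H ∧ (ψ x : G) = y

lemma NormExt.image_eq {F : FusionSystem S} {H A B : Subgroup G} {φ : A →* B}
    {ψ : ↥(A ⊔ H) →* ↥(B ⊔ H)} (h : F.NormExt H φ ψ) : image ψ = image φ ⊔ H := by
  obtain ⟨-, h2, h3⟩ := h
  have e : image ψ = (⊤ : Subgroup ↥(A ⊔ H)).map ((B ⊔ H).subtype.comp ψ) := by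
    rw [image, MonoidHom.range_eq_map]
  have t : (⊤ : Subgroup ↥(A ⊔ H)) = A.subgroupOf (A ⊔ H) ⊔ H.subgroupOf (A ⊔ H) := by
    rw [← Subgroup.subgroupOf_sup le_sup_left le_sup_right, Subgroup.subgroupOf_self]
  rw [e, t, Subgroup.map_sup]
  congr 1
  · ext y
    constructor
    · rintro ⟨x, hx, rfl⟩
      exact ⟨⟨x, hx⟩, (h2 ⟨x, hx⟩ x rfl).symm⟩
    · rintro ⟨a, rfl⟩
      exact ⟨⟨a, le_sup_left (a := A) (b := H) a.2⟩, a.2, h2 a _ rfl⟩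
  · ext y
    rw [h3 y]
    constructor
    · rintro ⟨x, hx, rfl⟩; exact ⟨x, hx, rfl⟩
    · rintro ⟨x, hx, rfl⟩; exact ⟨x, hx, rfl⟩

/-- The normalizer fusion system `N_F(H)` over `N_S(H)`: the morphisms `φ : A → B` of `F` between
subgroups of `N_S(H)` which extend to a morphism `A H → B H` of `F` mapping `H` onto `H`. -/
def normalizerSystem (F : FusionSystem S) {H : Subgroup G} (hH : H ≤ S) :
    FusionSystem (S ⊓ normalizer (H : Set G)) where
  Hom A B := {φ | A ≤ S ⊓ normalizer (H : Set G) ∧ B ≤ S ⊓ normalizer (H : Set G) ∧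
    φ ∈ F.Hom A B ∧ ∃ ψ, F.NormExt H φ ψ}
  source_le h := h.1
  target_le h := h.2.1
  injective h := F.injective h.2.2.1
  comp_mem := by
    rintro A B C ψ φ ⟨hB, hC, hψ, ψ', h1, h2, h3⟩ ⟨hA, -, hφ, φ', k1, k2, k3⟩
    refine ⟨hA, hC, F.comp_mem hψ hφ, ψ'.comp φ', F.comp_mem h1 k1, ?_, ?_⟩
    · intro a x hx
      exact h2 (φ a) (φ' x) (k2 a x hx)
    · intro y
      rw [h3 y]
      constructor
      · rintro ⟨x, hx, rfl⟩
        obtain ⟨w, hw, hwx⟩ := (k3 x).1 hx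
        refine ⟨w, hw, ?_⟩
        rw [MonoidHom.comp_apply, Subtype.ext hwx]
      · rintro ⟨w, hw, rfl⟩
        exact ⟨φ' w, (k3 _).2 ⟨w, hw, rfl⟩, rfl⟩
  conj_mem := by
    intro A B hA hB x hx φ hφ
    have hA' : A ⊔ H ≤ S := sup_le (hA.trans inf_le_left) hH
    have hB' : B ⊔ H ≤ S := sup_le (hB.trans inf_le_left) hH
    have hxH : ∀ y, y ∈ H ↔ x * y * x⁻¹ ∈ H := mem_normalizer_iff.1 hx.2
    have key : ∀ y ∈ A ⊔ H, x * y * x⁻¹ ∈ B ⊔ H := by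
      have : A ⊔ H ≤ (B ⊔ H).comap (MulAut.conj x).toMonoidHom := by
        refine sup_le (fun a ha => ?_) (fun a ha => ?_)
        · have := (φ ⟨a, ha⟩).2
          rw [hφ] at this
          exact le_sup_left (a := B) (b := H) this
        · exact le_sup_right (a := B) (b := H) ((hxH a).1 ha)
      exact fun y hy => this hy
    let ψ : ↥(A ⊔ H) →* ↥(B ⊔ H) :=
      { toFun := fun y => ⟨x * y * x⁻¹, key y y.2⟩
        map_one' := by simp
        map_mul' := fun y z => by apply Subtype.ext; simp [mul_assoc] }
    refine ⟨hA, hB, F.conj_mem (hA.trans inf_le_left) (hB.trans inf_le_left) x hx.1 φ hφ, ψ,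
      F.conj_mem hA' hB' x hx.1 ψ (fun _ => rfl), ?_, ?_⟩
    · intro a y hy
      rw [hφ, ← hy]; rfl
    · intro y
      constructor
      · intro hy
        have : x⁻¹ * y * x ∈ H := (hxH _).2 (by simpa [mul_assoc] using hy)
        exact ⟨⟨_, le_sup_right (a := A) (b := H) this⟩, this, by simp [ψ, mul_assoc]⟩
      · rintro ⟨z, hz, rfl⟩
        exact (hxH _).1 hz
  toImage_mem := by
    rintro A B φ ⟨hA, hB, hφ, ψ, hψ⟩
    have hN : image φ ≤ S ⊓ normalizer (H : Set G) := by
      rintro x ⟨a, rfl⟩; exact hB (φ a).2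
    have e := hψ.image_eq
    refine ⟨hA, hN, F.toImage_mem hφ,
      (Subgroup.inclusion e.le).comp (toImage ψ (F.injective hψ.1)).toMonoidHom, ?_, ?_, ?_⟩
    · refine F.mem_of_val hψ.1 rfl (sup_le (hN.trans inf_le_left) hH) ?_
      rintro a a' h
      rw [Subtype.ext h]; rfl
    · exact fun a x hx => hψ.2.1 a x hx
    · exact hψ.2.2
  toImage_symm_mem := by
    rintro A B φ ⟨hA, hB, hφ, ψ, hψ⟩
    have hN : image φ ≤ S ⊓ normalizer (H : Set G) := by
      rintro x ⟨a, rfl⟩; exact hB (φ a).2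
    have e := hψ.image_eq
    have hi := F.toImage_symm_mem hψ.1
    have hval : ∀ x : ↥(A ⊔ H),
        (toImage ψ (F.injective hψ.1)).symm ⟨(ψ x : G), x, rfl⟩ = x := fun x => by
      rw [MulEquiv.symm_apply_eq]; rfl
    refine ⟨hN, hA, F.toImage_symm_mem hφ,
      (toImage ψ (F.injective hψ.1)).symm.toMonoidHom.comp (Subgroup.inclusion e.ge), ?_, ?_, ?_⟩
    · refine F.mem_of_val hi e (sup_le (hA.trans inf_le_left) hH) ?_
      rintro a a' h
      have : (Subgroup.inclusion e.ge a') = a := Subtype.ext h.symm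
      rw [MonoidHom.comp_apply, this]
    · rintro a x hx
      obtain ⟨b, rfl⟩ := (toImage φ (F.injective hφ)).surjective a
      have hb : ((toImage φ (F.injective hφ) b : image φ) : G) = φ b := rfl
      have hm : (b : G) ∈ A ⊔ H := le_sup_left (a := A) (b := H) b.2
      have hx' : Subgroup.inclusion e.ge x = ⟨(ψ ⟨b, hm⟩ : G), ⟨b, hm⟩, rfl⟩ :=
        Subtype.ext (by
          rw [Subgroup.coe_inclusion, hx, hb]; exact (hψ.2.1 b ⟨b, hm⟩ rfl).symm)
      have l : ((toImage ψ (F.injective hψ.1)).symm.toMonoidHom.comp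
          (Subgroup.inclusion e.ge)) x = ⟨b, hm⟩ := by
        rw [MonoidHom.comp_apply, hx']; exact hval _
      rw [l]
      have r : (toImage φ (F.injective hφ)).symm.toMonoidHom
          (toImage φ (F.injective hφ) b) = b := MulEquiv.symm_apply_apply _ _
      rw [r]
    · intro y
      constructor
      · intro hy
        have hm : y ∈ A ⊔ H := le_sup_right (a := A) (b := H) hy
        have hz : (ψ ⟨y, hm⟩ : G) ∈ H := (hψ.2.2 _).2 ⟨⟨y, hm⟩, hy, rfl⟩
        refine ⟨⟨(ψ ⟨y, hm⟩ : G), le_sup_right (a := image φ) (b := H) hz⟩, hz, ?_⟩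
        exact congrArg Subtype.val (hval ⟨y, hm⟩)
      · rintro ⟨x, hx, rfl⟩
        obtain ⟨w, hw, hwx⟩ := (hψ.2.2 _).1 hx
        have hx' : Subgroup.inclusion e.ge x = ⟨(ψ w : G), w, rfl⟩ := Subtype.ext hwx.symm
        have l : ((toImage ψ (F.injective hψ.1)).symm.toMonoidHom.comp
            (Subgroup.inclusion e.ge)) x = w := by
          rw [MonoidHom.comp_apply, hx']; exact hval _
        rw [l]; exact hw

/-- The morphism of `O(F)` given by a morphism of `O(N_F(H))`. -/
def OrbHom.ofNormalizer {F : FusionSystem S} {H : Subgroup G} {hH : H ≤ S} {A B : Subgroup G}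
    (f : (F.normalizerSystem hH).OrbHom A B) : F.OrbHom A B :=
  Quotient.map (fun φ => ⟨φ.1, φ.2.2.2.1⟩) (fun _ _ h => h) f

/-! ### Normalizers after and before a morphism

Here `E` is a fusion system over a subgroup `T` (it will be `N_F(H)` over `N_S(H)`) and
`φ : A → K` is a morphism with `A ≤ T`. -/

section Normalizers

variable {T : Subgroup G} (E : FusionSystem T)

/-- The normalizer after `φ` in `E`: all `x ∈ N_K(φ(A))` with `φ⁻¹ c_x φ ∈ Aut_E(A)`. -/
def normAfter {A K : Subgroup G} (φ : A →* K) : Subgroup G where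
  carrier := {x | x ∈ K ⊓ normalizer (image φ : Set G) ∧
    ∃ α ∈ E.aut A, ∀ a : A, (φ (α a) : G) = x * φ a * x⁻¹}
  one_mem' := ⟨one_mem _, 1, one_mem _, fun a => by simp⟩
  mul_mem' := by
    rintro x y ⟨hx, α, hα, h⟩ ⟨hy, β, hβ, k⟩
    exact ⟨mul_mem hx hy, α * β, mul_mem hα hβ, fun a => by
      rw [MulAut.mul_apply, h, k]; simp [mul_assoc]⟩
  inv_mem' := by
    rintro x ⟨hx, α, hα, h⟩
    refine ⟨inv_mem hx, α⁻¹, inv_mem hα, fun a => ?_⟩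
    have := h (α⁻¹ a)
    rw [MulAut.apply_inv_self] at this
    rw [this]; simp [mul_assoc]

/-- The group of all `x ∈ N_T(A)` such that `φ c_x φ⁻¹` is conjugation on `φ(A)` by an element of
the normalizer after `φ` in `E`. -/
def normBefore {A K : Subgroup G} (φ : A →* K) : Subgroup G := conjLift T (E.normAfter φ) φ

/-- `φ` is its own `E`-top: `A` is fully `E`-normalized, and `Aut_M(φ(A)) = φ Aut_N(A) φ⁻¹` where
`M`, `N` are the normalizers after and before `φ`. -/
def IsTop {A K : Subgroup G} (φ : A →* K) (hφ : Function.Injective φ) : Prop :=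
  E.IsFullyNormalized A ∧
  autBy (E.normAfter φ) (image φ) =
    (autBy (E.normBefore φ) A).map (MulAut.congr (toImage φ hφ)).toMonoidHom

lemma normBefore_le_of_conj {A K : Subgroup G} {φ ψ : A →* K} (k : K)
    (h : ∀ a, ψ a = k * φ a * k⁻¹) : E.normBefore φ ≤ E.normBefore ψ := by
  have hv : ∀ a, (ψ a : G) = k * φ a * (k : G)⁻¹ := fun a => by rw [h]; simp
  have himg : ∀ z : G, z ∈ image ψ ↔ (k : G)⁻¹ * z * k ∈ image φ := by
    intro z
    constructor
    · rintro ⟨a, rfl⟩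
      exact ⟨a, by simp [hv, mul_assoc]⟩
    · rintro ⟨a, ha⟩
      refine ⟨a, ?_⟩
      have ha' : (φ a : G) = (k : G)⁻¹ * z * k := ha
      simp [hv, ha', mul_assoc]
  rintro x ⟨hx, y, ⟨⟨hyK, hyN⟩, α, hα, hy⟩, hxy⟩
  refine ⟨hx, k * y * (k : G)⁻¹, ⟨⟨?_, ?_⟩, α, hα, fun a => ?_⟩, fun a b hb => ?_⟩
  · exact K.mul_mem (K.mul_mem k.2 hyK) (K.inv_mem k.2)
  · refine mem_normalizer_iff.2 fun z => ?_
    rw [himg, himg, mem_normalizer_iff.1 hyN]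
    simp [mul_assoc]
  · rw [hv, hv, hy]; simp [mul_assoc]
  · rw [hv, hv, hxy a b hb]; simp [mul_assoc]

end Normalizers

variable {F : FusionSystem S} {T : Subgroup G}

/-- The normalizer before a morphism `f` of the orbit category; it does not depend on the
representative of `f`. -/
def OrbHom.normBefore (E : FusionSystem T) {A K : Subgroup G} (f : F.OrbHom A K) : Subgroup G :=
  Quotient.lift (fun φ : F.Hom A K => E.normBefore φ.1) (by
    rintro φ ψ ⟨k, h⟩
    refine le_antisymm (E.normBefore_le_of_conj k h) (E.normBefore_le_of_conj k⁻¹ fun a => ?_)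
    rw [h]; group) f

/-- Some representative of `f` is its own `E`-top. -/
def OrbHom.IsTop (E : FusionSystem T) {A K : Subgroup G} (f : F.OrbHom A K) : Prop :=
  ∃ φ : F.Hom A K, F.cls φ = f ∧ E.IsTop φ.1 (F.injective φ.2)

/-- `g : N → K` extends `f : A → K`: `A ≤ N` and `g ∘ ι = f` in the orbit category. -/
def OrbHom.Extends {A N K : Subgroup G} (g : F.OrbHom N K) (f : F.OrbHom A K) : Prop :=
  ∃ h : A ≤ N, g.comp (F.inclCls h g.source_le) = f

/-- `(A, f) ∼ (B, g)`: there is an isomorphism `θ : A → B` in `N_F(H)` with `f = g ∘ θ`. -/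
def NormEquiv (F : FusionSystem S) {H : Subgroup G} (hH : H ≤ S) {K : Subgroup G}
    (x y : F.Pair K) : Prop :=
  ∃ θ : (F.normalizerSystem hH).Hom x.1 y.1, Function.Surjective θ.1 ∧
    x.2 = y.2.comp (OrbHom.ofNormalizer ((F.normalizerSystem hH).cls θ))

/-- `Q` is a choice of `[N_F(H) × K]` inside the choice `P` of `[H ×_F K]`: it contains exactly
one element of each class of `P` under `∼`, and all its elements `(A, f)` have `A` fully
`N_F(H)`-normalized and `f` equal to its own `N_F(H)`-top. -/
def IsNormalizerReps (F : FusionSystem S) {H : Subgroup G} (hH : H ≤ S) {K : Subgroup G}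
    (P Q : Set (F.Pair K)) : Prop :=
  Q ⊆ P ∧
  (∀ x ∈ Q, (F.normalizerSystem hH).IsFullyNormalized x.1 ∧
    x.2.IsTop (F.normalizerSystem hH)) ∧
  ∀ x ∈ P, ∃! y, y ∈ Q ∧ F.NormEquiv hH x y

/-- The pair `(B, g ∘ f)` of `F` obtained from a pair `(B, f)` of `N_F(H)` with `f : B → N`, and
from `g : N → K`. -/
def compPair {H : Subgroup G} {hH : H ≤ S} {N K : Subgroup G} (g : F.OrbHom N K)
    (y : (F.normalizerSystem hH).Pair N) : F.Pair K :=
  ⟨y.1, g.comp (OrbHom.ofNormalizer y.2)⟩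

/-- `H` is contained in `N_S(H)`. -/
lemma le_inf_normalizer {H : Subgroup G} (hH : H ≤ S) : H ≤ S ⊓ normalizer (H : Set G) :=
  le_inf hH Subgroup.le_normalizer

end FusionSystem

end Fus

end

/-! Let `x = (A, φ) ∈ Q` and let `N` be the normalizer before `φ` in `N_F(H)`.

Existence and uniqueness of `φ̂ : N → K`. Elements of `N` act on `A` as elements of `K` act on
`φ(A)`. Saturation gives an extension with values in `S`, and centricity pushes it into `K`
(`IsSaturated.exists_extension_of_isCentric`). Two extensions differ by an automorphism trivial on
the normal centric subgroup `A`; this is conjugation by an element of `A`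
(`IsSaturated.exists_conj_of_eqOn`). Both arguments need fully normalized subgroups to be fully
automized, which the chosen definition of saturation only gives for `S` itself
(`IsSaturated.isFullyAutomized`).

The decomposition. Restricting `φ̂` to `N ⊓ H` gives a pair above `x`, so maximality forces `N ⊓ H =
A`. Over subgroups of `H`, morphisms of `N_F(H)` are restrictions of automorphisms of `H`; hence a
maximal pair `(B, ψ)` of `N_F(H)` over `H` and `N` is an isomorphism `θ : B → A` followed by the
inclusion. Thus `φ̂ψ = φθ` is again maximal and lies in the `N_F(H)`-class of `x`
(`IsMaximalPair.map`). Conversely, every element of `P` in that class is some `φθ = φ̂ ι θ`. As `Q`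
meets each class once, the pieces are disjoint and cover `P`.

Injectivity on a piece is where the top condition enters: if `φη` and `φθ` differ by `k ∈ K`, then
`k` lies in the normalizer after `φ`, so `η θ⁻¹` is conjugation by an element of `N`
(`eq_of_compPair_eq`). -/

noncomputable section

open Subgroup

namespace Fus

namespace FusionSystem

/-! ### Isomorphisms, centric subgroups and the extension axiom. -/

section Basic

variable {G : Type*} [Group G] {S : Subgroup G} (F : FusionSystem S)

/-- Morphisms may be restricted in the source and re-targeted. -/
lemma mem_restrict {A B A' B' : Subgroup G} {φ : A →* B} {φ' : A' →* B'}
    (hφ : φ ∈ F.Hom A B) (hA : A' ≤ A) (hB : B' ≤ S)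
    (h : ∀ (a : A) (a' : A'), (a : G) = a' → (φ a : G) = φ' a') : φ' ∈ F.Hom A' B' := by
  have hAS := F.source_le hφ
  have := F.comp_mem hφ (F.conj_mem (hA.trans hAS) hAS 1 S.one_mem (Subgroup.inclusion hA)
    (fun a => by simp))
  exact F.mem_of_val this rfl hB (fun a a' e => h _ _ (by simpa using e))

lemma inclusion_mem {A B : Subgroup G} (h : A ≤ B) (hB : B ≤ S) :
    Subgroup.inclusion h ∈ F.Hom A B :=
  F.conj_mem (h.trans hB) hB 1 S.one_mem _ (fun a => by simp)

lemma image_equiv {A B : Subgroup G} (e : A ≃* B) : image e.toMonoidHom = B := by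
  ext x
  constructor
  · rintro ⟨a, rfl⟩; exact (e a).2
  · intro hx; exact ⟨e.symm ⟨x, hx⟩, by simp⟩

lemma symm_mem {A B : Subgroup G} {e : A ≃* B} (h : e.toMonoidHom ∈ F.Hom A B) :
    e.symm.toMonoidHom ∈ F.Hom B A := by
  refine F.mem_restrict (F.toImage_symm_mem h) (image_equiv e).ge (F.source_le h) ?_
  intro a a' haa
  obtain ⟨x, rfl⟩ := e.surjective a'
  have : a = toImage e.toMonoidHom (F.injective h) x := Subtype.ext haa
  rw [this]
  exact congrArg Subtype.val ((MulEquiv.symm_apply_apply (toImage e.toMonoidHom (F.injective h))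
    x).trans (e.symm_apply_apply x).symm)

lemma isoIn_iff {A B : Subgroup G} :
    F.IsoIn A B ↔ ∃ e : A ≃* B, e.toMonoidHom ∈ F.Hom A B := by
  constructor
  · rintro ⟨φ, h, hs⟩
    exact ⟨MulEquiv.ofBijective φ ⟨F.injective h, hs⟩, h⟩
  · rintro ⟨e, h⟩
    exact ⟨e.toMonoidHom, h, e.surjective⟩

lemma isoIn_image {A B : Subgroup G} {φ : A →* B} (h : φ ∈ F.Hom A B) : F.IsoIn A (image φ) :=
  (F.isoIn_iff).2 ⟨_, F.toImage_mem h⟩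

variable {F}

lemma IsoIn.refl {A : Subgroup G} (hA : A ≤ S) : F.IsoIn A A :=
  (F.isoIn_iff).2 ⟨MulEquiv.refl A, F.conj_mem hA hA 1 S.one_mem _ (fun a => by simp)⟩

lemma IsoIn.symm {A B : Subgroup G} (h : F.IsoIn A B) : F.IsoIn B A := by
  obtain ⟨e, he⟩ := (F.isoIn_iff).1 h
  exact (F.isoIn_iff).2 ⟨e.symm, F.symm_mem he⟩

lemma IsoIn.trans {A B C : Subgroup G} (h : F.IsoIn A B) (k : F.IsoIn B C) : F.IsoIn A C := by
  obtain ⟨φ, hφ, hs⟩ := h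
  obtain ⟨ψ, hψ, hs'⟩ := k
  exact ⟨ψ.comp φ, F.comp_mem hψ hφ, hs'.comp hs⟩

lemma IsoIn.left_le {A B : Subgroup G} (h : F.IsoIn A B) : A ≤ S := by
  obtain ⟨φ, hφ, -⟩ := h
  exact F.source_le hφ

lemma IsoIn.right_le {A B : Subgroup G} (h : F.IsoIn A B) : B ≤ S := h.symm.left_le

lemma IsCentric.of_isoIn {A B : Subgroup G} (hA : F.IsCentric A) (h : F.IsoIn A B) :
    F.IsCentric B :=
  ⟨h.right_le, fun _ hC => hA.2 _ (h.trans hC)⟩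

/-- A morphism out of `B` restricts to `A`; whatever centralizes the image of `B` centralizes the
smaller image of `A`, hence lies in it. -/
lemma IsCentric.mono {A B : Subgroup G} (hA : F.IsCentric A) (h : A ≤ B) (hB : B ≤ S) :
    F.IsCentric B := by
  refine ⟨hB, ?_⟩
  rintro C ⟨φ, hφ, hs⟩
  have hr : φ.comp (Subgroup.inclusion h) ∈ F.Hom A C := F.comp_mem hφ (F.inclusion_mem h hB)
  have hle : image (φ.comp (Subgroup.inclusion h)) ≤ C := by
    rintro _ ⟨a, rfl⟩; exact SetLike.coe_mem _
  exact (inf_le_inf_left S (Subgroup.centralizer_le hle)).trans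
    ((hA.2 _ (F.isoIn_image hr)).trans hle)

variable (F)

/-- A morphism whose image lies in the image of a second one factors through the second one. -/
lemma exists_factor {A B D D' : Subgroup G} {σ : A →* D} {ρ : B →* D'} (hσ : σ ∈ F.Hom A D)
    (hρ : ρ ∈ F.Hom B D') (h : ∀ a, ∃ b, (σ a : G) = ρ b) :
    ∃ ψ ∈ F.Hom A B, ∀ a, (ρ (ψ a) : G) = σ a := by
  have hle : image σ ≤ image ρ := by
    rintro _ ⟨a, rfl⟩
    obtain ⟨b, hb⟩ := h a
    exact ⟨b, hb.symm⟩
  refine ⟨(toImage ρ (F.injective hρ)).symm.toMonoidHom.comp ((Subgroup.inclusion hle).comp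
    (toImage σ (F.injective hσ)).toMonoidHom), F.comp_mem (F.toImage_symm_mem hρ)
    (F.comp_mem (F.inclusion_mem hle (F.source_le (F.toImage_symm_mem hρ)))
      (F.toImage_mem hσ)), fun a => ?_⟩
  have : toImage ρ (F.injective hρ) ((toImage ρ (F.injective hρ)).symm
      (Subgroup.inclusion hle (toImage σ (F.injective hσ) a))) =
      Subgroup.inclusion hle (toImage σ (F.injective hσ) a) := MulEquiv.apply_symm_apply _ _
  exact congrArg Subtype.val this

lemma isPGroup_autBy {p : ℕ} (hS : IsPGroup p S) {A : Subgroup G} :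
    IsPGroup p (autBy S A) := by
  rintro ⟨α, x, hx, h⟩
  obtain ⟨k, hk⟩ := hS ⟨x, hx⟩
  refine ⟨k, Subtype.ext (MulEquiv.ext fun a => Subtype.ext ?_)⟩
  have hk' : x ^ p ^ k = 1 := congrArg Subtype.val hk
  have : ∀ n : ℕ, (((α ^ n) a : A) : G) = x ^ n * a * (x ^ n)⁻¹ := by
    intro n
    induction n with
    | zero => simp
    | succ n ih => rw [pow_succ', MulAut.mul_apply, h, ih]; simp [pow_succ', mul_assoc]
  change (((α ^ p ^ k) a : A) : G) = a
  rw [this, hk']; simp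

lemma autBy_le_aut {A : Subgroup G} : autBy S A ≤ F.aut A := by
  rintro α ⟨x, hx, h⟩ hA
  exact F.conj_mem hA hA x hx _ h

lemma finite_of_le [Finite S] {A : Subgroup G} (hA : A ≤ S) : Finite A :=
  Finite.of_injective _ (Subgroup.inclusion_injective hA)

lemma exists_isFullyNormalized [Finite S] {A : Subgroup G} (hA : A ≤ S) :
    ∃ C, F.IsoIn A C ∧ F.IsFullyNormalized C := by
  let P : ℕ → Prop := fun n => ∃ C, F.IsoIn A C ∧
    Nat.card ↥(S ⊓ normalizer (C : Set G)) = n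
  have hb : ∀ n, P n → n ≤ Nat.card S := by
    rintro n ⟨C, -, rfl⟩
    exact Subgroup.card_le_of_le inf_le_left
  classical
  obtain ⟨C, hC, hn⟩ : P (Nat.findGreatest P (Nat.card S)) :=
    Nat.findGreatest_spec (hb _ ⟨A, IsoIn.refl hA, rfl⟩) ⟨A, IsoIn.refl hA, rfl⟩
  refine ⟨C, hC, hC.right_le, fun B hB => ?_⟩
  rw [hn]
  have : P (Nat.card ↥(S ⊓ normalizer (B : Set G))) := ⟨B, hC.trans hB, rfl⟩
  exact Nat.le_findGreatest (hb _ this) this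

/-- Conjugation by `x` is carried by an extension `ψ` of `φ` to conjugation by `ψ x`. -/
lemma map_conj_of_extends {A B N D : Subgroup G} {φ : A →* B} {ψ : N →* D} (hle : A ≤ N)
    (h : ∀ (a : A) (n : N), (n : G) = a → (ψ n : G) = φ a) (x : N) (a b : A)
    (hb : (b : G) = x * a * (x : G)⁻¹) : (φ b : G) = ψ x * φ a * (ψ x : G)⁻¹ := by
  rw [← h a (Subgroup.inclusion hle a) rfl,
    ← h b (x * Subgroup.inclusion hle a * x⁻¹) (by simp [hb])]
  simp

/-- The extension axiom for isomorphisms onto a fully normalized subgroup. -/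
lemma IsSaturated.exists_extension {F : FusionSystem S} {p : ℕ} (hF : F.IsSaturated p)
    {A C N : Subgroup G} {e : A ≃* C} (he : e.toMonoidHom ∈ F.Hom A C)
    (hC : F.IsFullyNormalized C) (hN : N ≤ S ⊓ normalizer (A : Set G))
    (h : ∀ x ∈ N, ∃ z ∈ S ⊓ normalizer (C : Set G), ∀ a b : A, (b : G) = x * a * x⁻¹ →
      (e b : G) = z * e a * z⁻¹) :
    ∃ ψ ∈ F.Hom N S, ∀ (a : A) (n : N), (n : G) = a → (ψ n : G) = e a := by
  let φ : A →* S := (Subgroup.inclusion hC.1).comp e.toMonoidHom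
  have hφ : φ ∈ F.Hom A S := F.comp_mem (F.inclusion_mem hC.1 le_rfl) he
  have hi : image φ = C := (image_eq_of_val rfl
    (fun a a' e' => by rw [Subtype.ext e']; rfl)).trans (image_equiv e)
  have hx := hF.2 A φ hφ (hi ▸ hC)
  rw [hi] at hx
  obtain ⟨ψ, hψ, hext⟩ := hx
  have hle : N ≤ conjLift S (S ⊓ normalizer (C : Set G)) φ := fun x hx => ⟨hN hx, h x hx⟩
  exact ⟨ψ.comp (Subgroup.inclusion hle), F.comp_mem hψ (F.inclusion_mem hle (F.source_le hψ)),
    fun a n hn => congrArg Subtype.val (hext a (Subgroup.inclusion hle n) hn)⟩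

end Basic

/-! ### Fully normalized subgroups are fully automized. -/

section Saturation

variable {G : Type*} [Group G]

/-- Normalizers grow in finite `p`-groups, by nilpotency. Needed both inside `S` and inside a Sylow
subgroup of `Aut_F(C)`. -/
lemma exists_mem_normalizer_of_not_le {p : ℕ} [Fact p.Prime] {P Q : Subgroup G} [Finite P]
    (hP : IsPGroup p P) (hQP : Q ≤ P) (h : ¬ P ≤ Q) :
    ∃ g ∈ P, g ∉ Q ∧ g ∈ normalizer (Q : Set G) := by
  have : Group.IsNilpotent P := hP.isNilpotent
  have hlt : Q.subgroupOf P < ⊤ := lt_top_iff_ne_top.2 fun e => h (subgroupOf_eq_top.1 e)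
  obtain ⟨g, hg, hgQ⟩ := SetLike.exists_of_lt (Group.normalizerCondition_of_isNilpotent _ hlt)
  have : Finite Q := Finite.of_injective _ (Subgroup.inclusion_injective hQP)
  refine ⟨g, g.2, hgQ, mem_normalizer_fintype fun q hq => ?_⟩
  exact (mem_normalizer_iff.1 hg ⟨q, hQP hq⟩).1 hq

/-- An element of finite order has a power of `p`-power order whose exponent is `1` modulo a given
power of `p`. -/
lemma exists_pow_pow_eq_one {Γ : Type*} [Group Γ] [Finite Γ] {p : ℕ} [hp : Fact p.Prime] (ψ : Γ)
    (k : ℕ) : ∃ n j : ℕ, (ψ ^ n) ^ p ^ j = 1 ∧ n ≡ 1 [MOD p ^ k] := by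
  obtain ⟨j, m, hm, hj⟩ := Nat.exists_eq_pow_mul_and_not_dvd (orderOf_pos ψ).ne' p hp.1.ne_one
  have hc : Nat.Coprime (p ^ k) m := ((Nat.Prime.coprime_iff_not_dvd hp.1).2 hm).pow_left k
  -- With `m` the `p'`-part of the order, `n ≡ 0` mod `m` kills that part, while `n ≡ 1` mod `p ^ k`
  -- leaves elements of order dividing `p ^ k` unchanged.
  obtain ⟨n, h1, h0⟩ := Nat.chineseRemainder hc 1 0
  refine ⟨n, j, ?_, h1⟩
  rw [← pow_mul, ← orderOf_dvd_iff_pow_eq_one, hj, mul_comm]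
  exact mul_dvd_mul_right ((Nat.modEq_zero_iff_dvd).1 h0) _

lemma isPGroup_zpowers {Γ : Type*} [Group Γ] {p j : ℕ} {g : Γ} (h : g ^ p ^ j = 1) :
    IsPGroup p (zpowers g) := by
  rintro ⟨_, n, rfl⟩
  refine ⟨j, Subtype.ext ?_⟩
  change (g ^ n) ^ p ^ j = 1
  rw [← zpow_natCast, ← zpow_mul, mul_comm, zpow_mul, zpow_natCast, h, one_zpow]

variable {S : Subgroup G} {F : FusionSystem S}

lemma mem_normalizer_of_conj {C : Subgroup G} [Finite C] {z : G} (f : C → C)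
    (h : ∀ c : C, (f c : G) = z * c * z⁻¹) : z ∈ normalizer (C : Set G) :=
  mem_normalizer_fintype fun c hc => by
    rw [← h ⟨c, hc⟩]; exact SetLike.coe_mem _

/-- `Aut_S(A)` is a Sylow `p`-subgroup of `Aut_F(A)`. -/
def IsFullyAutomized (F : FusionSystem S) (p : ℕ) (A : Subgroup G) : Prop :=
  ∃ P : Sylow p (F.aut A), (P : Subgroup (F.aut A)).map (F.aut A).subtype = autBy S A

lemma IsFullyAutomized.exists_conj [Finite S] {p : ℕ} [Fact p.Prime] {C : Subgroup G}
    (hC : F.IsFullyAutomized p C) (hCS : C ≤ S) {R : Subgroup (MulAut C)} (hR : R ≤ F.aut C)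
    (hp : IsPGroup p R) : ∃ α ∈ F.aut C, ∀ β ∈ R, α * β * α⁻¹ ∈ autBy S C := by
  have : Finite C := finite_of_le hCS
  obtain ⟨P, hP⟩ := hC
  obtain ⟨Q, hQ⟩ := (hp.comap_subtype (K := F.aut C)).exists_le_sylow
  obtain ⟨g, hg⟩ := MulAction.exists_smul_eq (F.aut C) Q P
  refine ⟨g, g.2, fun β hβ => ?_⟩
  rw [← hP]
  have h1 : (⟨β, hR hβ⟩ : F.aut C) ∈ Q := hQ hβ
  have h2 : g * ⟨β, hR hβ⟩ * g⁻¹ ∈ P := by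
    rw [← hg]
    exact Subgroup.smul_mem_pointwise_smul _ (MulAut.conj g) _ h1
  exact ⟨_, h2, rfl⟩

lemma congr_mem_aut {B C : Subgroup G} {e : B ≃* C} (he : e.toMonoidHom ∈ F.Hom B C)
    {α : MulAut B} (hα : α ∈ F.aut B) : MulAut.congr e α ∈ F.aut C := fun _ =>
  F.comp_mem he (F.comp_mem (hα (F.source_le he)) (F.symm_mem he))

/-- An isomorphism to a fully automized subgroup can be chosen to carry a given `p`-group of
automorphisms to automorphisms induced by elements of `S`. -/
lemma IsFullyAutomized.exists_equiv [Finite S] {p : ℕ} [Fact p.Prime] {B C : Subgroup G}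
    (hC : F.IsFullyAutomized p C) (hBC : F.IsoIn B C) {R : Subgroup (MulAut B)}
    (hR : R ≤ F.aut B) (hp : IsPGroup p R) :
    ∃ τ : B ≃* C, τ.toMonoidHom ∈ F.Hom B C ∧
      ∀ α ∈ R, ∃ s ∈ S ⊓ normalizer (C : Set G), ∀ b, (τ (α b) : G) = s * τ b * s⁻¹ := by
  have : Finite C := finite_of_le hBC.right_le
  obtain ⟨e, he⟩ := isoIn_iff F |>.1 hBC
  -- Any isomorphism `e` moves `R` to a `p`-group in `Aut_F(C)`; by Sylow's theorem some `γ`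
  -- conjugates this group into `Aut_S(C)`, and `γ ∘ e` is the required isomorphism.
  obtain ⟨γ, hγ, h⟩ := hC.exists_conj hBC.right_le (R := R.map (MulAut.congr e).toMonoidHom)
    (by rintro _ ⟨α, hα, rfl⟩; exact congr_mem_aut he (hR hα)) (hp.map _)
  refine ⟨e.trans γ, F.comp_mem (hγ hBC.right_le) he, fun α hα => ?_⟩
  obtain ⟨s, hs, hsc⟩ := h _ ⟨α, hα, rfl⟩
  refine ⟨s, ⟨hs, mem_normalizer_of_conj _ hsc⟩, fun b => ?_⟩
  rw [← hsc]
  simp [MulAut.mul_apply]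

lemma exists_mulAut_conj {A : Subgroup G} {x : G} (hx : x ∈ S ⊓ normalizer (A : Set G)) :
    ∃ α ∈ autBy S A, ∀ a : A, (α a : G) = x * a * x⁻¹ :=
  ⟨normalizerMonoidHom A ⟨x, hx.2⟩, ⟨x, hx.1, fun _ => rfl⟩, fun _ => rfl⟩

/-- An isomorphism onto a fully normalized subgroup that carries `Aut_S(A)` into `Aut_S(C)`
extends to `N_S(A)`. -/
lemma IsSaturated.exists_extension_normalizer {p : ℕ} (hF : F.IsSaturated p)
    {A C : Subgroup G} {e : A ≃* C} (he : e.toMonoidHom ∈ F.Hom A C)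
    (hC : F.IsFullyNormalized C)
    (h : ∀ α ∈ autBy S A, ∃ s ∈ S ⊓ normalizer (C : Set G), ∀ a, (e (α a) : G) = s * e a * s⁻¹) :
    ∃ ψ ∈ F.Hom (S ⊓ normalizer (A : Set G)) S,
      ∀ (a : A) (n : ↥(S ⊓ normalizer (A : Set G))), (n : G) = a → (ψ n : G) = e a := by
  refine hF.exists_extension he hC le_rfl fun x hx => ?_
  obtain ⟨α, hα, hαx⟩ := exists_mulAut_conj hx
  obtain ⟨z, hz, hzc⟩ := h α hα
  refine ⟨z, hz, fun a b hb => ?_⟩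
  rw [← hzc, Subtype.ext (hb.trans (hαx a).symm)]

/-- In a saturated fusion system, a fully normalized subgroup is fully automized. -/
lemma IsSaturated.isFullyAutomized [Finite S] {p : ℕ} [Fact p.Prime] (hS : IsPGroup p S)
    (hF : F.IsSaturated p) {C : Subgroup G} (hC : F.IsFullyNormalized C) :
    F.IsFullyAutomized p C := by
  -- Induction on `|S| - |C|`: larger fully normalized subgroups may be assumed fully automized, and
  -- `C = S` is part of saturation.
  induction hn : Nat.card S - Nat.card C using Nat.strong_induction_on generalizing C with
  | _ n ih =>
  have hCS := hC.1
  have fC : Finite C := finite_of_le hCS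
  by_cases hSC : S ≤ C
  · obtain rfl : C = S := le_antisymm hCS hSC
    exact hF.1
  have hpQ : IsPGroup p ((autBy S C).subgroupOf (F.aut C)) :=
    (isPGroup_autBy hS).comap_subtype
  obtain ⟨P, hP⟩ := hpQ.exists_le_sylow
  by_cases hle : (P : Subgroup (F.aut C)) ≤ (autBy S C).subgroupOf (F.aut C)
  · refine ⟨P, ?_⟩
    rw [le_antisymm hle hP, Subgroup.map_subgroupOf_eq_of_le (autBy_le_aut F)]
  exfalso
  -- If `Aut_S(C)` were not Sylow, some `φ` of `p`-power order outside it would normalize it. The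
  -- rest of the proof shows that such a `φ` is conjugation by an element of `S` after all.
  obtain ⟨⟨φ, hφ⟩, hφP, hφQ, hφN⟩ := exists_mem_normalizer_of_not_le P.2 hP hle
  apply hφQ
  obtain ⟨k, hk⟩ := P.2 ⟨_, hφP⟩
  have hk : φ ^ p ^ k = 1 := congrArg (fun x => ((x : P) : F.aut C).1) hk
  set N := S ⊓ normalizer (C : Set G) with hN
  have fN : Finite N := finite_of_le inf_le_left
  have hCN : C ≤ N := le_inf hCS Subgroup.le_normalizer
  obtain ⟨ψ₀, hψ₀, hext₀⟩ := hF.exists_extension_normalizer (e := φ) (hφ hCS) hC (by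
    intro α hα
    obtain ⟨z, hz, hzc⟩ : φ * α * φ⁻¹ ∈ autBy S C :=
      (mem_normalizer_iff.1 hφN ⟨α, autBy_le_aut F hα⟩).1 hα
    refine ⟨z, ⟨hz, mem_normalizer_of_conj _ hzc⟩, fun a => ?_⟩
    rw [← hzc]; simp [MulAut.mul_apply])
  -- The extension `ψ₀` maps `C` onto `C`, so its values normalize `C`; it therefore restricts to an
  -- automorphism of `N`.
  have hrange : ∀ x, ∃ y : N, (ψ₀ x : G) = (Subgroup.inclusion (inf_le_left : N ≤ S)) y := by
    intro x
    refine ⟨⟨ψ₀ x, (ψ₀ x).2, mem_normalizer_fintype fun c hc => ?_⟩, rfl⟩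
    have hm : (x : G) * (φ⁻¹ ⟨c, hc⟩ : C) * (x : G)⁻¹ ∈ C :=
      (mem_normalizer_iff.1 x.2.2 _).1 (SetLike.coe_mem _)
    have := map_conj_of_extends (φ := φ.toMonoidHom) hCN hext₀ x (φ⁻¹ ⟨c, hc⟩) ⟨_, hm⟩ rfl
    have h2 : ((φ.toMonoidHom (φ⁻¹ ⟨c, hc⟩) : C) : G) = c :=
      congrArg Subtype.val (MulAut.apply_inv_self _ φ _)
    rw [h2] at this
    rw [← this]; exact SetLike.coe_mem _
  obtain ⟨ψ₁, hψ₁, hψ₁e⟩ := F.exists_factor hψ₀ (F.inclusion_mem inf_le_left le_rfl) hrange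
  let ψ : MulAut N := MulEquiv.ofBijective ψ₁ ⟨F.injective hψ₁,
    Finite.surjective_of_injective (F.injective hψ₁)⟩
  have hψ : ψ ∈ F.aut N := fun _ => hψ₁
  have hψe : ∀ c : C, ((ψ (Subgroup.inclusion hCN c) : N) : G) = φ c := fun c =>
    (hψ₁e _).trans (hext₀ c _ rfl)
  -- Replace `ψ` by a power of `p`-power order that still restricts to `φ` on `C`.
  obtain ⟨m, j, hmj, hm⟩ := exists_pow_pow_eq_one (p := p) ψ k
  have hpow : ∀ (n : ℕ) (c : C), (((ψ ^ n) (Subgroup.inclusion hCN c) : N) : G) =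
      ((φ ^ n) c : C) := by
    intro n
    induction n with
    | zero => simp
    | succ n ih =>
      intro c
      rw [pow_succ', pow_succ', MulAut.mul_apply, MulAut.mul_apply, ← hψe]
      congr 2
      exact Subtype.ext (ih c)
  have hφm : φ ^ m = φ := by
    rw [pow_eq_pow_of_modEq hm hk, pow_one]
  obtain ⟨N', hNN', hN'⟩ := exists_isFullyNormalized (F := F) (A := N) inf_le_left
  have hcard : Nat.card N' = Nat.card N := by
    obtain ⟨e, -⟩ := isoIn_iff F |>.1 hNN'
    exact (Nat.card_congr e.toEquiv).symm
  -- This strict inequality makes the induction hypothesis available for `N'`, which has the order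
  -- of `N`.
  have hlt : Nat.card C < Nat.card N := by
    obtain ⟨g, hg, hgC, hgN⟩ := exists_mem_normalizer_of_not_le hS hCS hSC
    by_contra hge
    exact hgC (Subgroup.eq_of_le_of_card_ge hCN (not_lt.1 hge) ▸ ⟨hg, hgN⟩)
  have hNS : Nat.card N ≤ Nat.card S := Subgroup.card_le_of_le inf_le_left
  obtain ⟨τ, hτ, hτR⟩ := (ih _ (by omega) hN' rfl).exists_equiv hNN'
    (R := zpowers (ψ ^ m)) (by simpa using (F.aut N).pow_mem hψ m)
    (isPGroup_zpowers hmj)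
  obtain ⟨s, hs, hsτ⟩ := hτR _ (mem_zpowers _)
  have hres : τ.toMonoidHom.comp (Subgroup.inclusion hCN) ∈ F.Hom C N' :=
    F.comp_mem hτ (F.inclusion_mem hCN inf_le_left)
  set C' := image (τ.toMonoidHom.comp (Subgroup.inclusion hCN)) with hC'
  have hCC' : F.IsoIn C C' := F.isoIn_image hres
  have fC' : Finite C' := finite_of_le hCC'.right_le
  have hN'le : N' ≤ S ⊓ normalizer (C' : Set G) := by
    intro y hy
    obtain ⟨x, hx⟩ := τ.surjective ⟨y, hy⟩
    refine ⟨hN'.1 hy, mem_normalizer_fintype ?_⟩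
    rintro _ ⟨c, rfl⟩
    have hm : (x : G) * c * (x : G)⁻¹ ∈ C := (mem_normalizer_iff.1 x.2.2 _).1 c.2
    refine ⟨⟨_, hm⟩, ?_⟩
    have : Subgroup.inclusion hCN ⟨_, hm⟩ = x * Subgroup.inclusion hCN c * x⁻¹ :=
      Subtype.ext (by simp)
    have hy' : y = (τ x : G) := (congrArg Subtype.val hx).symm
    simp [this, hy']
  -- `N' = τ(N)` normalizes `C' = τ(C)`, and full normalization of `C` bounds `|N_S(C')|` by `|N| =
  -- |N'|`.
  have hN'eq : N' = S ⊓ normalizer (C' : Set G) :=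
    have : Finite ↥(S ⊓ normalizer (C' : Set G)) := finite_of_le inf_le_left
    Subgroup.eq_of_le_of_card_ge hN'le ((hC.2 _ hCC').trans hcard.ge)
  have hsφ : ∀ c : C, s * (τ (Subgroup.inclusion hCN c) : G) * s⁻¹ =
      τ (Subgroup.inclusion hCN (φ c)) := by
    intro c
    rw [← hsτ]
    congr 2
    exact Subtype.ext ((hpow m c).trans (by rw [hφm]; rfl))
  -- `s` acts on `C'` as `τ φ τ⁻¹`, so it normalizes `C'`. Being in `N' = τ(N)`, it pulls back to
  -- some `y ∈ N` that induces `φ` on `C`.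
  have hsN' : s ∈ N' := by
    rw [hN'eq]
    refine ⟨hs.1, mem_normalizer_fintype ?_⟩
    rintro _ ⟨c, rfl⟩
    exact ⟨φ c, (hsφ c).symm⟩
  obtain ⟨y, hy⟩ := τ.surjective ⟨s, hsN'⟩
  refine ⟨y, y.2.1, fun c => ?_⟩
  have h1 : τ (Subgroup.inclusion hCN (φ c)) = τ (y * Subgroup.inclusion hCN c * y⁻¹) := by
    refine Subtype.ext ?_
    rw [← hsφ]; simp [hy]
  have := congrArg Subtype.val (τ.injective h1)
  simpa using this

end Saturation

/-! ### Extending morphisms from centric subgroups, and uniqueness of extensions. -/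

section Extension

variable {G : Type*} [Group G] {S : Subgroup G} {F : FusionSystem S}

/-- The form in which centricity is used below: elements of `S` acting alike on a centric subgroup
lie in the same coset of it. -/
lemma mem_of_forall_commute {C : Subgroup G} (hC : F.IsCentric C) {s t : G} (hs : s ∈ S)
    (ht : t ∈ S) (h : ∀ c ∈ C, s * c * s⁻¹ = t * c * t⁻¹) : t⁻¹ * s ∈ C := by
  refine hC.2 C (IsoIn.refl hC.1) ⟨S.mul_mem (S.inv_mem ht) hs, mem_centralizer_iff.2 ?_⟩
  intro c hc
  have := h c hc
  calc c * (t⁻¹ * s) = t⁻¹ * (t * c * t⁻¹) * s := by group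
    _ = t⁻¹ * (s * c * s⁻¹) * s := by rw [this]
    _ = t⁻¹ * s * c := by group

/-- A morphism `φ : A → K` from a centric subgroup extends, with values in `K`, to every group
`N` of elements normalizing `A` whose action on `A` is carried by `φ` to conjugation by elements
of `K`. -/
lemma IsSaturated.exists_extension_of_isCentric [Finite S] {p : ℕ} [Fact p.Prime]
    (hS : IsPGroup p S) (hF : F.IsSaturated p) {A K N : Subgroup G} {φ : A →* K}
    (hφ : φ ∈ F.Hom A K) (hA : F.IsCentric A) (hAN : A ≤ N)
    (hN : N ≤ S ⊓ normalizer (A : Set G))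
    (h : ∀ x ∈ N, ∃ y ∈ K ⊓ normalizer (image φ : Set G), ∀ a b : A, (b : G) = x * a * x⁻¹ →
      (φ b : G) = y * φ a * y⁻¹) :
    ∃ ψ ∈ F.Hom N K, ∀ (a : A) (n : N), (n : G) = a → ψ n = φ a := by
  have hKS := F.target_le hφ
  set B := image φ with hB
  have hAB : F.IsoIn A B := F.isoIn_image hφ
  have hBK : B ≤ K := by rintro _ ⟨a, rfl⟩; exact SetLike.coe_mem _
  -- The extension axiom requires a fully normalized target, which `B = φ(A)` need not be. So `ρ : B
  -- → C` is extended to `ρ'` on `N_S(B)`, `ρ φ` is extended to `σ` on `N`, and the result is `ρ'⁻¹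
  -- σ`.
  obtain ⟨C, hBC, hC⟩ := exists_isFullyNormalized (F := F) hAB.right_le
  have fC : Finite C := finite_of_le hC.1
  obtain ⟨ρ, hρ, hρR⟩ := (hF.isFullyAutomized hS hC).exists_equiv hBC (R := autBy S B)
    (autBy_le_aut F) (isPGroup_autBy hS)
  obtain ⟨ρ', hρ', hρe⟩ := hF.exists_extension_normalizer hρ hC hρR
  have hBN : B ≤ S ⊓ normalizer (B : Set G) := le_inf hAB.right_le Subgroup.le_normalizer
  have hCc := (hA.of_isoIn hAB).of_isoIn hBC
  have hKN : K ⊓ normalizer (B : Set G) ≤ S ⊓ normalizer (B : Set G) := inf_le_inf_right _ hKS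
  let e : A ≃* C := (toImage φ (F.injective hφ)).trans ρ
  have hconj : ∀ (x y : G) (hy : y ∈ K ⊓ normalizer (B : Set G)),
      (∀ a b : A, (b : G) = x * a * x⁻¹ → (φ b : G) = y * φ a * y⁻¹) →
      ∀ a b : A, (b : G) = x * a * x⁻¹ →
        (e b : G) = ρ' ⟨y, hKN hy⟩ * e a * (ρ' ⟨y, hKN hy⟩ : G)⁻¹ := fun x y hy hxy a b hb =>
    map_conj_of_extends (φ := ρ.toMonoidHom) hBN hρe ⟨y, hKN hy⟩ (toImage φ (F.injective hφ) a)
      (toImage φ (F.injective hφ) b) (hxy a b hb)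
  have hmem : ∀ (x y : G) (hx : x ∈ N) (hy : y ∈ K ⊓ normalizer (B : Set G)),
      (∀ a b : A, (b : G) = x * a * x⁻¹ → (φ b : G) = y * φ a * y⁻¹) →
      ∀ c : C, ∃ b : A, (e b : G) = ρ' ⟨y, hKN hy⟩ * c * (ρ' ⟨y, hKN hy⟩ : G)⁻¹ := by
    intro x y hx hy hxy c
    obtain ⟨a, rfl⟩ := e.surjective c
    exact ⟨⟨_, (mem_normalizer_iff.1 (hN hx).2 _).1 a.2⟩, hconj x y hy hxy a _ rfl⟩
  obtain ⟨σ, hσ, hσe⟩ := hF.exists_extension (e := e)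
    (F.comp_mem hρ (F.toImage_mem hφ)) hC hN (by
      intro x hx
      obtain ⟨y, hy, hxy⟩ := h x hx
      refine ⟨ρ' ⟨y, hKN hy⟩, ⟨(ρ' _).2, mem_normalizer_fintype fun c hc => ?_⟩,
        hconj x y hy hxy⟩
      obtain ⟨b, hb⟩ := hmem x y hx hy hxy ⟨c, hc⟩
      rw [← hb]; exact (e b).2)
  -- `σ x` and `ρ' y` act alike on the centric subgroup `C = ρ(B)`, so they differ by an element of
  -- `ρ(B)`. As `B ≤ K`, this keeps `σ x` in `ρ'(N_K(B))`, which is why the extension takes values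
  -- in `K`.
  have hfac : ∀ x : N, ∃ w : ↥(K ⊓ normalizer (B : Set G)),
      (σ x : G) = ρ'.comp (Subgroup.inclusion hKN) w := by
    rintro ⟨x, hx⟩
    obtain ⟨y, hy, hxy⟩ := h x hx
    have : (ρ' ⟨y, hKN hy⟩ : G)⁻¹ * σ ⟨x, hx⟩ ∈ C := by
      refine mem_of_forall_commute hCc (σ _).2 (ρ' _).2 fun c hc => ?_
      obtain ⟨a, ha⟩ := e.surjective ⟨c, hc⟩
      obtain rfl : c = e a := (congrArg Subtype.val ha).symm
      have hm := (mem_normalizer_iff.1 (hN hx).2 _).1 a.2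
      exact (map_conj_of_extends (φ := e.toMonoidHom) hAN hσe ⟨x, hx⟩ a ⟨_, hm⟩ rfl).symm.trans
        (hconj x y hy hxy a ⟨_, hm⟩ rfl)
    obtain ⟨b, hb⟩ := ρ.surjective ⟨_, this⟩
    have hbm : (b : G) ∈ K ⊓ normalizer (B : Set G) := ⟨hBK b.2, Subgroup.le_normalizer b.2⟩
    refine ⟨⟨y, hy⟩ * ⟨b, hbm⟩, ?_⟩
    rw [map_mul, Subgroup.coe_mul]
    have h1 : ((ρ'.comp (Subgroup.inclusion hKN)) ⟨b, hbm⟩ : G) =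
        (ρ' ⟨y, hKN hy⟩ : G)⁻¹ * σ ⟨x, hx⟩ :=
      (hρe b _ rfl).trans (congrArg Subtype.val hb)
    rw [h1]
    exact (mul_inv_cancel_left _ _).symm
  obtain ⟨ψ, hψ, hψe⟩ := F.exists_factor hσ
    (F.comp_mem hρ' (F.inclusion_mem hKN inf_le_left)) hfac
  refine ⟨(Subgroup.inclusion inf_le_left).comp ψ,
    F.comp_mem (F.inclusion_mem inf_le_left hKS) hψ, fun a n hn => ?_⟩
  have hφm : (φ a : G) ∈ K ⊓ normalizer (B : Set G) :=
    ⟨(φ a).2, Subgroup.le_normalizer ⟨a, rfl⟩⟩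
  have : ψ n = ⟨φ a, hφm⟩ := by
    apply F.injective (F.comp_mem hρ' (F.inclusion_mem hKN inf_le_left))
    refine Subtype.ext ((hψe n).trans ((hσe a n hn).trans ?_))
    exact (hρe (toImage φ (F.injective hφ) a) _ rfl).symm
  have h2 : (ψ n : G) = φ a := congrArg Subtype.val this
  exact Subtype.ext h2

/-- The displacement `x⁻¹ α(x)` lies in `A` and is fixed by `α`, so it accumulates multiplicatively.
This bounds the order of `α` by a power of `p`. -/
lemma exists_mul_of_conj {N A : Subgroup G} {α : MulAut N} (hAN : A ≤ N)
    (hα : ∀ a : A, α (Subgroup.inclusion hAN a) = Subgroup.inclusion hAN a)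
    (hc : ∀ x : N, (x : G)⁻¹ * α x ∈ A) (n : ℕ) (x : N) :
    ((α ^ n) x : N) = x * (x⁻¹ * α x) ^ n := by
  induction n with
  | zero => simp
  | succ n ih =>
    have h1 : α (x⁻¹ * α x) = x⁻¹ * α x := hα ⟨_, hc x⟩
    rw [pow_succ', MulAut.mul_apply, ih, map_mul, map_pow, h1, pow_succ', ← mul_assoc x,
      mul_inv_cancel_left]

/-- An automorphism that is trivial on a normal centric subgroup `A` is conjugation by an element
of `A`. -/
lemma IsSaturated.exists_conj_of_aut [Finite S] {p : ℕ} [Fact p.Prime]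
    (hS : IsPGroup p S) (hF : F.IsSaturated p) {A N : Subgroup G} (hA : F.IsCentric A)
    (hAN : A ≤ N) (hN : N ≤ S ⊓ normalizer (A : Set G)) {α : MulAut N} (hα : α ∈ F.aut N)
    (hfix : ∀ a : A, α (Subgroup.inclusion hAN a) = Subgroup.inclusion hAN a) :
    ∃ z : A, ∀ x : N, (α x : G) = z * x * (z : G)⁻¹ := by
  have hNS : N ≤ S := hN.trans inf_le_left
  have hc : ∀ x : N, (x : G)⁻¹ * α x ∈ A := by
    intro x
    refine mem_of_forall_commute hA (hNS (α x).2) (hNS x.2) fun a ha => ?_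
    have hm : (x : G) * a * (x : G)⁻¹ ∈ A := (mem_normalizer_iff.1 (hN x.2).2 _).1 ha
    have h1 := hfix ⟨_, hm⟩
    have h2 : Subgroup.inclusion hAN ⟨_, hm⟩ = x * Subgroup.inclusion hAN ⟨a, ha⟩ * x⁻¹ :=
      Subtype.ext (by simp)
    rw [h2, map_mul, map_mul, hfix] at h1
    simpa using congrArg Subtype.val h1
  obtain ⟨k, hk⟩ := IsPGroup.iff_card.1 hS
  have hpow : α ^ p ^ k = 1 := by
    refine MulEquiv.ext fun x => ?_
    rw [exists_mul_of_conj hAN hfix hc]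
    have : (x⁻¹ * α x) ^ p ^ k = 1 := by
      refine Subgroup.inclusion_injective hNS ?_
      rw [map_pow, map_one, ← hk]
      exact pow_card_eq_one'
    rw [this, mul_one]; rfl
  obtain ⟨N', hNN', hN'⟩ := exists_isFullyNormalized (F := F) hNS
  obtain ⟨τ, hτ, hτR⟩ := (hF.isFullyAutomized hS hN').exists_equiv hNN'
    (R := zpowers α) (by simpa using hα) (isPGroup_zpowers hpow)
  obtain ⟨s, hs, hsτ⟩ := hτR _ (mem_zpowers _)
  have hres : τ.toMonoidHom.comp (Subgroup.inclusion hAN) ∈ F.Hom A N' :=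
    F.comp_mem hτ (F.inclusion_mem hAN hNS)
  -- After transport by `τ`, `α` is conjugation by `s`, which centralizes `τ(A)` because `α` fixes
  -- `A`; hence `s ∈ τ(A)`.
  have hsA := mem_of_forall_commute (hA.of_isoIn (F.isoIn_image hres)) hs.1 S.one_mem (by
    rintro _ ⟨a, rfl⟩
    have := hsτ (Subgroup.inclusion hAN a)
    rw [hfix] at this
    simpa using this.symm)
  obtain ⟨z, hz⟩ := hsA
  have hz : (τ (Subgroup.inclusion hAN z) : G) = s := by simpa using hz
  refine ⟨z, fun x => ?_⟩
  have h1 : τ (α x) = τ (Subgroup.inclusion hAN z * x * (Subgroup.inclusion hAN z)⁻¹) := by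
    refine Subtype.ext ?_
    rw [hsτ, map_mul, map_mul, map_inv]
    simp [hz]
  simpa using congrArg Subtype.val (τ.injective h1)

/-- Two morphisms that agree on a normal centric subgroup differ by a conjugation. -/
lemma IsSaturated.exists_conj_of_eqOn [Finite S] {p : ℕ} [Fact p.Prime]
    (hS : IsPGroup p S) (hF : F.IsSaturated p) {A N K : Subgroup G} (hA : F.IsCentric A)
    (hAN : A ≤ N) (hN : N ≤ S ⊓ normalizer (A : Set G)) {ψ ψ' : N →* K} (hψ : ψ ∈ F.Hom N K)
    (hψ' : ψ' ∈ F.Hom N K)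
    (h : ∀ a : A, ψ' (Subgroup.inclusion hAN a) = ψ (Subgroup.inclusion hAN a)) :
    ∃ k : K, ∀ x, ψ' x = k * ψ x * k⁻¹ := by
  have hNS : N ≤ S := hN.trans inf_le_left
  have fN : Finite N := finite_of_le hNS
  have hKS := F.target_le hψ
  -- `ψ' x` and `ψ x` act alike on `ψ(A)`, so they differ by an element of `ψ(A)`; thus `ψ⁻¹ ψ'` is
  -- an automorphism of `N` that fixes `A`.
  have hfac : ∀ x : N, ∃ y : N, (ψ' x : G) = ψ y := by
    intro x
    have hres : ψ.comp (Subgroup.inclusion hAN) ∈ F.Hom A K :=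
      F.comp_mem hψ (F.inclusion_mem hAN hNS)
    obtain ⟨a, ha⟩ := mem_of_forall_commute (hA.of_isoIn (F.isoIn_image hres))
      (hKS (ψ' x).2) (hKS (ψ x).2) (by
        rintro _ ⟨a, rfl⟩
        have hm : (x : G) * a * (x : G)⁻¹ ∈ A := (mem_normalizer_iff.1 (hN x.2).2 _).1 a.2
        have h1 := h ⟨_, hm⟩
        have h2 : Subgroup.inclusion hAN ⟨_, hm⟩ = x * Subgroup.inclusion hAN a * x⁻¹ :=
          Subtype.ext (by simp)
        rw [h2, map_mul, map_mul, map_mul, map_mul, h] at h1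
        simpa using congrArg Subtype.val h1)
    refine ⟨x * Subgroup.inclusion hAN a, ?_⟩
    have ha : (ψ (Subgroup.inclusion hAN a) : G) = (ψ x : G)⁻¹ * ψ' x := ha
    rw [map_mul, Subgroup.coe_mul, ha, mul_inv_cancel_left]
  obtain ⟨α₀, hα₀, hα₀e⟩ := F.exists_factor hψ' hψ hfac
  let α : MulAut N := MulEquiv.ofBijective α₀ ⟨F.injective hα₀,
    Finite.surjective_of_injective (F.injective hα₀)⟩
  have hαe : ∀ x, ψ (α x) = ψ' x := fun x => Subtype.ext (hα₀e x)
  obtain ⟨z, hz⟩ := hF.exists_conj_of_aut hS hA hAN hN (α := α) (fun _ => hα₀)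
    (fun a => F.injective hψ (by rw [hαe, h]))
  refine ⟨ψ (Subgroup.inclusion hAN z), fun x => ?_⟩
  rw [← hαe, ← map_mul, ← map_inv, ← map_mul]
  exact congrArg ψ (Subtype.ext (by rw [hz]; simp))

end Extension

/-! ### The preorder on pairs, and the extension to the normalizer before a morphism. -/

section Pairs

variable {G : Type*} [Group G] {S : Subgroup G} {F : FusionSystem S}

lemma cls_eq_iff {A K : Subgroup G} {φ ψ : F.Hom A K} :
    F.cls φ = F.cls ψ ↔ ∃ k : K, ∀ a, ψ.1 a = k * φ.1 a * k⁻¹ :=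
  Quotient.eq (r := F.orbitSetoid A K)

lemma exists_cls {A K : Subgroup G} (f : F.OrbHom A K) : ∃ φ, F.cls φ = f :=
  Quotient.exists_rep f

/-- Elementwise form of the preorder: `k` witnesses equality of classes in the orbit category, and
the subgroup `A^h` disappears. -/
lemma pairLE_iff {H K A B : Subgroup G} {hH : H ≤ S} {φ : F.Hom A K} {ψ : F.Hom B K} :
    F.PairLE hH ⟨A, F.cls φ⟩ ⟨B, F.cls ψ⟩ ↔ ∃ h ∈ H, ∃ k ∈ K, ∀ a : A, ∃ b : B,
      (b : G) = h⁻¹ * a * h ∧ (ψ.1 b : G) = k * φ.1 a * k⁻¹ := by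
  constructor
  · rintro ⟨h, hh, hle, e⟩
    obtain ⟨k, hk⟩ := cls_eq_iff.1 e
    refine ⟨h, hh, k, k.2, fun a => ?_⟩
    have hm : h⁻¹ * (a : G) * h ∈ conjSubgroup A h := ⟨a, a.2, by simp⟩
    refine ⟨⟨_, hle hm⟩, rfl, ?_⟩
    have h1 := congrArg Subtype.val (hk ⟨_, hm⟩)
    have h2 : conjHom A h ⟨_, hm⟩ = a := Subtype.ext (by simp [conjHom, mul_assoc])
    rw [MonoidHom.comp_apply, MonoidHom.comp_apply] at h1
    rw [h2] at h1
    exact h1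
  · rintro ⟨h, hh, k, hk, e⟩
    have hle : conjSubgroup A h ≤ B := by
      rintro _ ⟨a, ha, rfl⟩
      obtain ⟨b, hb, -⟩ := e ⟨a, ha⟩
      simp [← hb]
    refine ⟨h, hh, hle, cls_eq_iff.2 ⟨⟨k, hk⟩, fun a => Subtype.ext ?_⟩⟩
    obtain ⟨b, hb, hb'⟩ := e (conjHom A h a)
    have : Subgroup.inclusion hle a = b := Subtype.ext (by simp [hb, conjHom, mul_assoc])
    rw [MonoidHom.comp_apply, MonoidHom.comp_apply]
    rw [this]
    exact hb'

lemma PairLE.isCentric {H K : Subgroup G} {hH : H ≤ S} {x y : F.Pair K} (h : F.PairLE hH x y)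
    (hx : F.IsCentric x.1) : F.IsCentric y.1 := by
  obtain ⟨c, hc, hle, -⟩ := h
  refine (hx.of_isoIn (IsoIn.symm ?_)).mono hle y.2.source_le
  have hle' : conjSubgroup x.1 c ≤ S := hle.trans y.2.source_le
  refine ⟨conjHom x.1 c, F.conj_mem hle' hx.1 c (hH hc) _ fun _ => rfl, fun a => ?_⟩
  exact ⟨⟨c⁻¹ * a * c, a, a.2, by simp⟩, Subtype.ext (by simp [conjHom, mul_assoc])⟩

lemma exists_injective_of_pairLE {A B : Subgroup G} {h : G} {P : A → B → Prop}
    (e : ∀ a : A, ∃ b : B, (b : G) = h⁻¹ * a * h ∧ P a b) :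
    ∃ f : A → B, Function.Injective f ∧ ∀ a, (f a : G) = h⁻¹ * a * h ∧ P a (f a) := by
  choose f hf using e
  refine ⟨f, fun a b hab => ?_, hf⟩
  have := (hf a).1.symm.trans ((congrArg Subtype.val hab).trans (hf b).1)
  exact Subtype.ext (by simpa using this)

lemma PairLE.card_le [Finite S] {H K : Subgroup G} {hH : H ≤ S} {x y : F.Pair K}
    (h : F.PairLE hH x y) : Nat.card x.1 ≤ Nat.card y.1 := by
  obtain ⟨A, f⟩ := x
  obtain ⟨B, g⟩ := y
  obtain ⟨φ, rfl⟩ := exists_cls f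
  obtain ⟨ψ, rfl⟩ := exists_cls g
  obtain ⟨c, -, k, -, e⟩ := pairLE_iff.1 h
  obtain ⟨u, hu, -⟩ := exists_injective_of_pairLE e
  have : Finite B := finite_of_le (F.source_le ψ.2)
  exact Nat.card_le_card_of_injective u hu

/-- A relation `x ≾ y` embeds one domain in the other by conjugation. If the orders agree, this is a
bijection and `c⁻¹`, `k⁻¹` reverse the relation. -/
lemma isMaximalPair_iff_card [Finite S] {H K : Subgroup G} {hH : H ≤ S} {x : F.Pair K} :
    F.IsMaximalPair hH K x ↔ F.IsPair H K x ∧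
      ∀ y, F.IsPair H K y → F.PairLE hH x y → Nat.card y.1 ≤ Nat.card x.1 := by
  refine and_congr_right fun hx => forall₃_congr fun y hy hxy => ⟨PairLE.card_le, fun hc => ?_⟩
  obtain ⟨A, f⟩ := x
  obtain ⟨B, g⟩ := y
  obtain ⟨φ, rfl⟩ := exists_cls f
  obtain ⟨ψ, rfl⟩ := exists_cls g
  obtain ⟨c, hcH, k, hk, e⟩ := pairLE_iff.1 hxy
  obtain ⟨u, hu, hue⟩ := exists_injective_of_pairLE e
  have : Finite B := finite_of_le (F.source_le ψ.2)
  have hs := (hu.bijective_of_nat_card_le hc).2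
  refine pairLE_iff.2 ⟨c⁻¹, H.inv_mem hcH, k⁻¹, K.inv_mem hk, fun b => ?_⟩
  obtain ⟨a, rfl⟩ := hs b
  exact ⟨a, by simp [(hue a).1, mul_assoc], by simp [(hue a).2, mul_assoc]⟩

/-- An extension in the orbit category has a representative that extends a given representative. -/
lemma OrbHom.Extends.exists_rep {A N K : Subgroup G} {g : F.OrbHom N K} {φ : F.Hom A K}
    (h : g.Extends (F.cls φ)) : ∃ γ : F.Hom N K, F.cls γ = g ∧ ∃ hAN : A ≤ N,
      ∀ a, γ.1 (Subgroup.inclusion hAN a) = φ.1 a := by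
  obtain ⟨γ₀, rfl⟩ := exists_cls g
  obtain ⟨hAN, e⟩ := h
  obtain ⟨k, hk⟩ := cls_eq_iff.1 e
  have hKS := F.target_le γ₀.2
  refine ⟨⟨(MulAut.conj k).toMonoidHom.comp γ₀.1, F.comp_mem (F.conj_mem hKS hKS k (hKS k.2) _
    fun a => by simp) γ₀.2⟩, (cls_eq_iff.2 ⟨k, fun a => by simp⟩).symm, hAN, fun a => ?_⟩
  rw [hk]; simp

lemma extends_of_eq {A N K : Subgroup G} {γ : F.Hom N K} {φ : F.Hom A K} (hAN : A ≤ N)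
    (h : ∀ a, γ.1 (Subgroup.inclusion hAN a) = φ.1 a) : (F.cls γ).Extends (F.cls φ) :=
  ⟨hAN, congrArg F.cls (Subtype.ext (MonoidHom.ext h))⟩

lemma normBefore_le {T A K : Subgroup G} (E : FusionSystem T) (φ : A →* K) :
    E.normBefore φ ≤ T ⊓ normalizer (A : Set G) := fun _ hx => hx.1

lemma OrbHom.normBefore_le {T A K : Subgroup G} (E : FusionSystem T) (f : F.OrbHom A K) :
    f.normBefore E ≤ T := by
  obtain ⟨φ, rfl⟩ := exists_cls f
  exact (FusionSystem.normBefore_le E φ.1).trans inf_le_left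

/-- Conjugation by `x ∈ A` is carried by `φ` to conjugation by `φ x`. -/
lemma le_normBefore {T A K : Subgroup G} (E : FusionSystem T) (φ : A →* K) (hA : A ≤ T) :
    A ≤ E.normBefore φ := by
  intro x hx
  refine ⟨⟨hA hx, Subgroup.le_normalizer hx⟩, φ ⟨x, hx⟩, ⟨⟨(φ _).2,
    Subgroup.le_normalizer ⟨_, rfl⟩⟩, MulAut.conj ⟨x, hx⟩,
    fun _ => E.conj_mem hA hA x (hA hx) _ fun a => by simp, fun a => by simp⟩, fun a b hb => ?_⟩
  have : b = ⟨x, hx⟩ * a * ⟨x, hx⟩⁻¹ := Subtype.ext hb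
  simp [this]

/-- The extension of a morphism from a centric subgroup to the normalizer before it. -/
lemma IsSaturated.existsUnique_extends [Finite S] {p : ℕ} [Fact p.Prime] (hS : IsPGroup p S)
    (hF : F.IsSaturated p) {T : Subgroup G} (E : FusionSystem T) (hT : T ≤ S) {A K : Subgroup G}
    (hA : F.IsCentric A) (hAT : A ≤ T) (f : F.OrbHom A K) :
    ∃! g : F.OrbHom (f.normBefore E) K, g.Extends f := by
  obtain ⟨φ, rfl⟩ := exists_cls f
  have hN : E.normBefore φ.1 ≤ S ⊓ normalizer (A : Set G) :=
    (normBefore_le E φ.1).trans (inf_le_inf_right _ hT)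
  have hAN := le_normBefore E φ.1 hAT
  obtain ⟨γ, hγ, hγe⟩ := hF.exists_extension_of_isCentric hS φ.2 hA hAN hN (by
    rintro x ⟨-, y, hy, hxy⟩
    exact ⟨y, hy.1, hxy⟩)
  refine ⟨F.cls ⟨γ, hγ⟩, extends_of_eq hAN fun a => hγe a _ rfl, fun g hg => ?_⟩
  obtain ⟨γ', rfl, hAN', hγ'⟩ := hg.exists_rep
  obtain ⟨k, hk⟩ := hF.exists_conj_of_eqOn hS hA hAN hN γ'.2 hγ fun a =>
    (hγe a _ rfl).trans (hγ' a).symm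
  exact cls_eq_iff.2 ⟨k, hk⟩

end Pairs

/-! ### Comparing maximal pairs of `N_F(H)` with maximal pairs of `F`. -/

section Normalizer

variable {G : Type*} [Group G] {S : Subgroup G} {F : FusionSystem S} {H : Subgroup G}
  {hH : H ≤ S}

lemma isCentric_normalizerSystem {A : Subgroup G} (hA : F.IsCentric A)
    (h : A ≤ S ⊓ normalizer (H : Set G)) : (F.normalizerSystem hH).IsCentric A := by
  refine ⟨h, ?_⟩
  rintro B ⟨φ, hφ, hs⟩
  exact (inf_le_inf_right _ inf_le_left).trans (hA.2 B ⟨φ, hφ.2.2.1, hs⟩)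

lemma compPair_cls {N K B : Subgroup G} (γ : F.Hom N K) (ψ : (F.normalizerSystem hH).Hom B N) :
    compPair (F.cls γ) ⟨B, (F.normalizerSystem hH).cls ψ⟩ =
      ⟨B, F.cls ⟨γ.1.comp ψ.1, F.comp_mem γ.2 ψ.2.2.2.1⟩⟩ := rfl

lemma compPair_inclCls_comp {A B N K : Subgroup G} (g : F.OrbHom N K) (hAN : A ≤ N)
    (hN : N ≤ S ⊓ normalizer (H : Set G)) (f : (F.normalizerSystem hH).OrbHom B A) :
    compPair g ⟨B, ((F.normalizerSystem hH).inclCls hAN hN).comp f⟩ =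
      ⟨B, (g.comp (F.inclCls hAN g.source_le)).comp (OrbHom.ofNormalizer f)⟩ := by
  obtain ⟨γ, rfl⟩ := exists_cls g
  obtain ⟨θ, rfl⟩ := exists_cls f
  rfl

lemma PairLE.map {N K : Subgroup G} (g : F.OrbHom N K)
    {y z : (F.normalizerSystem hH).Pair N}
    (h : (F.normalizerSystem hH).PairLE (le_inf_normalizer hH) y z) :
    F.PairLE hH (compPair g y) (compPair g z) := by
  obtain ⟨B, f⟩ := y
  obtain ⟨C, f'⟩ := z
  obtain ⟨ψ, rfl⟩ := exists_cls f
  obtain ⟨ω, rfl⟩ := exists_cls f'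
  obtain ⟨γ, rfl⟩ := exists_cls g
  obtain ⟨c, hc, n, hn, e⟩ := pairLE_iff.1 h
  rw [compPair_cls, compPair_cls]
  refine pairLE_iff.2 ⟨c, hc, γ.1 ⟨n, hn⟩, SetLike.coe_mem _, fun b => ?_⟩
  obtain ⟨d, hd, hd'⟩ := e b
  have : ω.1 d = ⟨n, hn⟩ * ψ.1 b * ⟨n, hn⟩⁻¹ := Subtype.ext hd'
  exact ⟨d, hd, by simp [this]⟩

/-- A pair of `N_F(H)` is maximal if its image under a morphism of `O(F)` is maximal. -/
lemma isMaximalPair_of_compPair [Finite S] {N K : Subgroup G} (g : F.OrbHom N K)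
    {y : (F.normalizerSystem hH).Pair N} (h : F.IsMaximalPair hH K (compPair g y)) :
    (F.normalizerSystem hH).IsMaximalPair (le_inf_normalizer hH) N y := by
  have : Finite ↥(S ⊓ normalizer (H : Set G)) := finite_of_le inf_le_left
  refine isMaximalPair_iff_card.2 ⟨⟨h.1.1, isCentric_normalizerSystem h.1.2
    (h.1.1.trans (le_inf_normalizer hH))⟩, fun z hz hyz => ?_⟩
  -- `z` is only given as `N_F(H)`-centric; `F`-centricity is inherited from the pair below it.
  have hle := hyz.map g
  exact (isMaximalPair_iff_card.1 h).2 _ ⟨hz.1, hle.isCentric h.1.2⟩ hle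

/-- A morphism of `N_F(H)` from a subgroup of `H` extends to an automorphism of `H`. -/
lemma exists_aut_of_mem_normalizerSystem [Finite S] {B N : Subgroup G} {ψ : B →* N}
    (hψ : ψ ∈ (F.normalizerSystem hH).Hom B N) (hB : B ≤ H) :
    ∃ β ∈ F.aut H, ∀ b : B, (β (Subgroup.inclusion hB b) : G) = ψ b := by
  obtain ⟨-, -, -, χ, hχ, h1, h2⟩ := hψ
  have fH : Finite H := finite_of_le hH
  obtain ⟨β₀, hβ₀, hβe⟩ := F.exists_factor
    (F.comp_mem hχ (F.inclusion_mem (le_sup_right : H ≤ B ⊔ H) (F.source_le hχ)))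
    (F.inclusion_mem hH le_rfl) (fun a => ⟨⟨_, (h2 _).2 ⟨_, a.2, rfl⟩⟩, rfl⟩)
  let β : MulAut H := MulEquiv.ofBijective β₀ ⟨F.injective hβ₀,
    Finite.surjective_of_injective (F.injective hβ₀)⟩
  exact ⟨β, fun _ => hβ₀, fun b => (hβe (Subgroup.inclusion hB b)).trans (h1 b _ rfl)⟩

/-- Converse of `exists_aut_of_mem_normalizerSystem`: since `C ≤ H`, the product `C H` is `H`, and
`β` itself is the extension required in `N_F(H)`. -/
lemma mem_normalizerSystem_of_aut {C N : Subgroup G} {β : MulAut H} (hβ : β ∈ F.aut H)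
    (hC : C ≤ H) (hN : N ≤ S ⊓ normalizer (H : Set G)) {ω : C →* N}
    (h : ∀ c, (ω c : G) = β (Subgroup.inclusion hC c)) :
    ω ∈ (F.normalizerSystem hH).Hom C N := by
  have hNS : N ≤ S := hN.trans inf_le_left
  have hCH : C ⊔ H ≤ H := sup_le hC le_rfl
  have hNH : N ⊔ H ≤ S := sup_le hNS hH
  refine ⟨hC.trans (le_inf_normalizer hH), hN, F.mem_restrict (hβ hH) hC hNS ?_,
    (Subgroup.inclusion le_sup_right).comp (β.toMonoidHom.comp (Subgroup.inclusion hCH)),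
    F.comp_mem (F.inclusion_mem le_sup_right hNH) (F.comp_mem (hβ hH) (F.inclusion_mem hCH hH)),
    ?_, ?_⟩
  · intro a a' e
    rw [h]
    exact congrArg (fun x => (β x : G)) (Subtype.ext e)
  · intro a x e
    rw [h]
    exact congrArg (fun x => (β x : G)) (Subtype.ext e)
  · intro y
    constructor
    · intro hy
      refine ⟨⟨β⁻¹ ⟨y, hy⟩, le_sup_right (a := C) (SetLike.coe_mem _)⟩, SetLike.coe_mem _, ?_⟩
      exact congrArg Subtype.val (MulAut.apply_inv_self _ β ⟨y, hy⟩)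
    · rintro ⟨x, -, rfl⟩
      exact (β (Subgroup.inclusion hCH x)).2

/-- The domain of a maximal pair is the intersection of `H` with the domain of any extension. -/
lemma inf_eq_of_extends [Finite S] {A N K : Subgroup G} {φ : F.Hom A K}
    (hx : F.IsMaximalPair hH K ⟨A, F.cls φ⟩) {γ : F.Hom N K} (hAN : A ≤ N)
    (h : ∀ a, γ.1 (Subgroup.inclusion hAN a) = φ.1 a) : N ⊓ H = A := by
  have hle : A ≤ N ⊓ H := le_inf hAN hx.1.1
  have : Finite ↥(N ⊓ H) := finite_of_le (inf_le_right.trans hH)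
  have hc := (isMaximalPair_iff_card.1 hx).2 ⟨N ⊓ H, F.cls ⟨γ.1.comp (Subgroup.inclusion inf_le_left),
    F.comp_mem γ.2 (F.inclusion_mem inf_le_left (F.source_le γ.2))⟩⟩
    ⟨inf_le_right, hx.1.2.mono hle (inf_le_right.trans hH)⟩
    (pairLE_iff.2 ⟨1, H.one_mem, 1, K.one_mem, fun a => ⟨Subgroup.inclusion hle a, by simp,
      by simp [← h]; rfl⟩⟩)
  exact (Subgroup.eq_of_le_of_card_ge hle hc).symm

/-- A maximal pair of `N_F(H)` over `H` and `N` is given by an isomorphism onto `N ⊓ H`. -/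
lemma IsMaximalPair.exists_equiv [Finite S] {A N B : Subgroup G} (hA : N ⊓ H = A)
    {ψ : (F.normalizerSystem hH).Hom B N}
    (h : (F.normalizerSystem hH).IsMaximalPair (le_inf_normalizer hH) N
      ⟨B, (F.normalizerSystem hH).cls ψ⟩) :
    ∃ θ : (F.normalizerSystem hH).Hom B A, Function.Surjective θ.1 ∧
      ∀ b, (θ.1 b : G) = ψ.1 b := by
  have : Finite ↥(S ⊓ normalizer (H : Set G)) := finite_of_le inf_le_left
  have hBH : B ≤ H := h.1.1
  obtain ⟨β, hβ, hβe⟩ := exists_aut_of_mem_normalizerSystem ψ.2 hBH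
  have hAH : A ≤ H := hA ▸ inf_le_right
  have hAN : A ≤ N := hA ▸ inf_le_left
  have hNT : N ≤ S ⊓ normalizer (H : Set G) := ψ.2.2.1
  have hr : ∀ b, (ψ.1 b : G) ∈ A := fun b => by
    rw [← hA]
    exact ⟨(ψ.1 b).2, by rw [← hβe]; exact SetLike.coe_mem _⟩
  let θ : B →* A := (N.subtype.comp ψ.1).codRestrict A hr
  refine ⟨⟨θ, mem_normalizerSystem_of_aut hβ hBH (hAN.trans hNT) fun b => (hβe b).symm⟩, ?_,
    fun _ => rfl⟩
  -- `C = β⁻¹(A)` is the largest subgroup of `H` that `β` maps into `N ⊓ H = A`. It carries a pair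
  -- above `(B, ψ)`, so maximality gives `B = C` and hence surjectivity onto `A`.
  let C : Subgroup G := ((A.subgroupOf H).comap β.toMonoidHom).map H.subtype
  have hCH : C ≤ H := by rintro _ ⟨c, -, rfl⟩; exact c.2
  have fC : Finite C := finite_of_le (hCH.trans hH)
  have hCA : ∀ c : C, (β (Subgroup.inclusion hCH c) : G) ∈ A := by
    rintro ⟨_, c, hc, rfl⟩; exact hc
  let ω : C →* N := ((H.subtype.comp β.toMonoidHom).comp (Subgroup.inclusion hCH)).codRestrict N
    fun c => hAN (hCA c)
  have hω : ω ∈ (F.normalizerSystem hH).Hom C N :=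
    mem_normalizerSystem_of_aut hβ hCH hNT fun _ => rfl
  have hBC : B ≤ C := fun b hb => ⟨⟨b, hBH hb⟩, by
    have := hr ⟨b, hb⟩
    rw [← hβe] at this
    exact this, rfl⟩
  have hc := (isMaximalPair_iff_card.1 h).2
    ⟨C, (F.normalizerSystem hH).cls ⟨ω, hω⟩⟩
    ⟨hCH, h.1.2.mono hBC (hCH.trans (le_inf_normalizer hH))⟩
    (pairLE_iff.2 ⟨1, H.one_mem, 1, N.one_mem, fun b => ⟨Subgroup.inclusion hBC b, by simp, by
      rw [one_mul, inv_one, mul_one, ← hβe]; rfl⟩⟩)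
  have hBC' : B = C := Subgroup.eq_of_le_of_card_ge hBC hc
  intro a
  have hm : (β⁻¹ (Subgroup.inclusion hAH a) : G) ∈ B := by
    rw [hBC']
    refine ⟨_, ?_, rfl⟩
    have : β (β⁻¹ (Subgroup.inclusion hAH a)) = Subgroup.inclusion hAH a :=
      MulAut.apply_inv_self _ _ _
    change ((β (β⁻¹ (Subgroup.inclusion hAH a)) : H) : G) ∈ A
    rw [this]; exact a.2
  refine ⟨⟨_, hm⟩, Subtype.ext ?_⟩
  change (ψ.1 ⟨_, hm⟩ : G) = a
  rw [← hβe]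
  exact congrArg Subtype.val (MulAut.apply_inv_self _ β (Subgroup.inclusion hAH a))

/-- Maximality is preserved under composition with isomorphisms of `N_F(H)`. -/
lemma IsMaximalPair.comp_equiv [Finite S] {A B K : Subgroup G} {φ : F.Hom A K}
    (hx : F.IsMaximalPair hH K ⟨A, F.cls φ⟩) (hB : B ≤ H)
    (θ : (F.normalizerSystem hH).Hom B A) (hθ : Function.Surjective θ.1) :
    F.IsMaximalPair hH K ⟨B, F.cls ⟨φ.1.comp θ.1, F.comp_mem φ.2 θ.2.2.2.1⟩⟩ := by
  have hBA : F.IsoIn B A := ⟨θ.1, θ.2.2.2.1, hθ⟩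
  obtain ⟨β, hβ, hβe⟩ := exists_aut_of_mem_normalizerSystem θ.2 hB
  refine isMaximalPair_iff_card.2 ⟨⟨hB, hx.1.2.of_isoIn hBA.symm⟩, ?_⟩
  rintro ⟨C, f⟩ ⟨hCH, hC⟩ hle
  obtain ⟨ω, rfl⟩ := exists_cls f
  obtain ⟨c, hc, k, hk, e⟩ := pairLE_iff.1 hle
  have hCH : C ≤ H := hCH
  have hr : β.toMonoidHom.comp (Subgroup.inclusion hCH) ∈ F.Hom C H :=
    F.comp_mem (hβ hH) (F.inclusion_mem hCH hH)
  let ε := toImage _ (F.injective hr)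
  have hC' : image (β.toMonoidHom.comp (Subgroup.inclusion hCH)) ≤ H := by
    rintro _ ⟨c, rfl⟩; exact SetLike.coe_mem _
  -- Transport by `β` turns a pair above the one on `B` into a pair above the one on `A = β(B)`,
  -- with conjugation by `c` becoming conjugation by `β c`.
  have h1 := (isMaximalPair_iff_card.1 hx).2 ⟨_, F.cls ⟨ω.1.comp ε.symm.toMonoidHom,
    F.comp_mem ω.2 (F.toImage_symm_mem hr)⟩⟩ ⟨hC', hC.of_isoIn (F.isoIn_image hr)⟩
    (pairLE_iff.2 ⟨β ⟨c, hc⟩, SetLike.coe_mem _, k, hk, fun a => by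
      obtain ⟨b, rfl⟩ := hθ a
      obtain ⟨d, hd, hd'⟩ := e b
      refine ⟨ε d, ?_, ?_⟩
      · have : Subgroup.inclusion hCH d = ⟨c, hc⟩⁻¹ * Subgroup.inclusion hB b * ⟨c, hc⟩ :=
          Subtype.ext hd
        change (β (Subgroup.inclusion hCH d) : G) = _
        rw [this, ← hβe]; simp
      · change (ω.1 (ε.symm (ε d)) : G) = _
        rw [MulEquiv.symm_apply_apply]
        exact hd'⟩)
  have h2 : Nat.card C = Nat.card (image (β.toMonoidHom.comp (Subgroup.inclusion hCH))) :=
    Nat.card_congr ε.toEquiv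
  have h3 : Nat.card B = Nat.card A :=
    Nat.card_congr (Equiv.ofBijective θ.1 ⟨F.injective θ.2.2.2.1, hθ⟩)
  change Nat.card C ≤ Nat.card B
  rw [h2, h3]
  exact h1

/-- The image of a maximal pair of `N_F(H)` under an extension of a maximal pair `x` is maximal
and equivalent to `x`. -/
lemma IsMaximalPair.map [Finite S] {N K : Subgroup G} {x : F.Pair K}
    (hx : F.IsMaximalPair hH K x) {g : F.OrbHom N K} (hg : g.Extends x.2)
    {y : (F.normalizerSystem hH).Pair N}
    (hy : (F.normalizerSystem hH).IsMaximalPair (le_inf_normalizer hH) N y) :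
    F.IsMaximalPair hH K (compPair g y) ∧ F.NormEquiv hH (compPair g y) x := by
  obtain ⟨A, f⟩ := x
  obtain ⟨B, f'⟩ := y
  obtain ⟨φ, rfl⟩ := exists_cls f
  obtain ⟨ψ, rfl⟩ := exists_cls f'
  obtain ⟨γ, rfl, hAN, hγ⟩ := hg.exists_rep
  obtain ⟨θ, hθ, hθe⟩ := hy.exists_equiv (inf_eq_of_extends hx hAN hγ)
  have e : compPair (F.cls γ) ⟨B, (F.normalizerSystem hH).cls ψ⟩ =
      ⟨B, F.cls ⟨φ.1.comp θ.1, F.comp_mem φ.2 θ.2.2.2.1⟩⟩ := by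
    rw [compPair_cls]
    congr 2
    refine Subtype.ext (MonoidHom.ext fun b => ?_)
    have : ψ.1 b = Subgroup.inclusion hAN (θ.1 b) := Subtype.ext (hθe b).symm
    rw [MonoidHom.comp_apply, MonoidHom.comp_apply, this, hγ]
  rw [e]
  exact ⟨hx.comp_equiv hy.1.1 θ hθ, θ, hθ, rfl⟩

/-- Composition with an extension of a maximal pair that is its own top is injective on maximal
pairs. -/
lemma eq_of_compPair_eq [Finite S] {K : Subgroup G} {x : F.Pair K}
    (hx : F.IsMaximalPair hH K x) (ht : x.2.IsTop (F.normalizerSystem hH))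
    {g : F.OrbHom (x.2.normBefore (F.normalizerSystem hH)) K} (hg : g.Extends x.2)
    {y z : (F.normalizerSystem hH).Pair (x.2.normBefore (F.normalizerSystem hH))}
    (hy : (F.normalizerSystem hH).IsMaximalPair (le_inf_normalizer hH) _ y)
    (hz : (F.normalizerSystem hH).IsMaximalPair (le_inf_normalizer hH) _ z)
    (h : compPair g y = compPair g z) : y = z := by
  obtain ⟨A, f⟩ := x
  obtain ⟨B, f₁⟩ := y
  obtain ⟨B', f₂⟩ := z
  obtain ⟨φ, hφ, ht⟩ : ∃ φ : F.Hom A K, F.cls φ = f ∧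
    (F.normalizerSystem hH).IsTop φ.1 (F.injective φ.2) := ht
  subst hφ
  obtain ⟨ψ, rfl⟩ := exists_cls f₁
  obtain ⟨ω, rfl⟩ := exists_cls f₂
  obtain ⟨γ, rfl, hAN, hγ⟩ := hg.exists_rep
  rw [compPair_cls, compPair_cls] at h
  obtain ⟨rfl, h⟩ := Sigma.mk.inj_iff.1 h
  obtain ⟨k, hk⟩ := cls_eq_iff.1 (eq_of_heq h)
  have hinf := inf_eq_of_extends hx hAN hγ
  obtain ⟨θ, hθ, hθe⟩ := hy.exists_equiv hinf
  obtain ⟨η, hη, hηe⟩ := hz.exists_equiv hinf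
  have hψ : ∀ b, ψ.1 b = Subgroup.inclusion hAN (θ.1 b) := fun b => Subtype.ext (hθe b).symm
  have hω : ∀ b, ω.1 b = Subgroup.inclusion hAN (η.1 b) := fun b => Subtype.ext (hηe b).symm
  have hk' : ∀ b, (φ.1 (η.1 b) : G) = k * φ.1 (θ.1 b) * (k : G)⁻¹ := by
    intro b
    have := congrArg Subtype.val (hk b)
    rw [MonoidHom.comp_apply, MonoidHom.comp_apply, hψ, hω, hγ, hγ] at this
    exact this
  let eθ : B ≃* A := MulEquiv.ofBijective θ.1 ⟨(F.normalizerSystem hH).injective θ.2, hθ⟩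
  let eη : B ≃* A := MulEquiv.ofBijective η.1 ⟨(F.normalizerSystem hH).injective η.2, hη⟩
  let α : MulAut A := eθ.symm.trans eη
  have hα : α ∈ (F.normalizerSystem hH).aut A := fun _ =>
    (F.normalizerSystem hH).comp_mem (B := B) (ψ := η.1) (φ := eθ.symm.toMonoidHom) η.2
      ((F.normalizerSystem hH).symm_mem (e := eθ) θ.2)
  have hαe : ∀ b, α (θ.1 b) = η.1 b := fun b => congrArg eη (eθ.symm_apply_apply b)
  have hαk : ∀ a, (φ.1 (α a) : G) = k * φ.1 a * (k : G)⁻¹ := by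
    intro a
    obtain ⟨b, rfl⟩ := hθ a
    rw [hαe, hk']
  have fI : Finite (image φ.1) := finite_of_le (F.isoIn_image φ.2).right_le
  -- `α = η θ⁻¹` is an automorphism of `A` in `N_F(H)` that `φ` carries to conjugation by `k`, which
  -- is exactly membership in the normalizer after `φ`.
  have hkN : (k : G) ∈ (F.normalizerSystem hH).normAfter φ.1 := by
    refine ⟨⟨k.2, mem_normalizer_fintype ?_⟩, α, hα, hαk⟩
    rintro _ ⟨a, rfl⟩
    exact ⟨α a, hαk a⟩
  obtain ⟨δ, hδ, hδk⟩ := exists_mulAut_conj (S := (F.normalizerSystem hH).normAfter φ.1)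
    (A := image φ.1) ⟨hkN, hkN.1.2⟩
  -- The top condition replaces `k` by some `n` in the normalizer before `φ` that induces `α` on
  -- `A`; this `n` identifies the two classes over that normalizer.
  rw [ht.2] at hδ
  obtain ⟨α', ⟨n, hn, hα'n⟩, rfl⟩ := hδ
  have hα' : ∀ a, α' a = α a := by
    intro a
    apply F.injective φ.2
    refine Subtype.ext ?_
    rw [hαk]
    have h1 := hδk (toImage φ.1 (F.injective φ.2) a)
    have h2 : MulAut.congr (toImage φ.1 (F.injective φ.2)) α' (toImage φ.1 (F.injective φ.2) a) =
        toImage φ.1 (F.injective φ.2) (α' a) :=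
      congrArg (fun a => toImage φ.1 (F.injective φ.2) (α' a)) (MulEquiv.symm_apply_apply _ a)
    exact (congrArg Subtype.val h2).symm.trans h1
  congr 1
  refine cls_eq_iff.2 ⟨⟨n, hn⟩, fun b => Subtype.ext ?_⟩
  rw [← hηe, ← hαe, ← hα', hα'n, hθe]
  rfl

/-- A pair that is equivalent to the image of a pair of `N_F(H)` is itself such an image. -/
lemma exists_compPair_eq [Finite S] {N K : Subgroup G} (g : F.OrbHom N K)
    {y : (F.normalizerSystem hH).Pair N} {z : F.Pair K} (hyH : y.1 ≤ H) (hzH : z.1 ≤ H)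
    (h : F.PairLE hH (compPair g y) z) (h' : F.PairLE hH z (compPair g y)) :
    ∃ w, compPair g w = z ∧
      (F.normalizerSystem hH).PairLE (le_inf_normalizer hH) y w ∧
      (F.normalizerSystem hH).PairLE (le_inf_normalizer hH) w y := by
  have hc := h'.card_le
  obtain ⟨B, f⟩ := y
  obtain ⟨C, f'⟩ := z
  obtain ⟨ψ, rfl⟩ := exists_cls f
  obtain ⟨χ, rfl⟩ := exists_cls f'
  obtain ⟨γ, rfl⟩ := exists_cls g
  rw [compPair_cls] at h
  obtain ⟨c, hcH, k, hk, e⟩ := pairLE_iff.1 h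
  obtain ⟨u, hu, hue⟩ := exists_injective_of_pairLE e
  have fC : Finite C := finite_of_le (F.source_le χ.2)
  have hs := (hu.bijective_of_nat_card_le hc).2
  have hT := le_inf_normalizer hH
  have hm : ∀ d : C, c * (d : G) * c⁻¹ ∈ B := by
    intro d
    obtain ⟨b, rfl⟩ := hs d
    rw [(hue b).1]; simp [mul_assoc]
  -- Equal orders give `C = B^c`, so `c_c : C → B` is an isomorphism lying in `N_F(H)`, and `ψ ∘
  -- c_c` is the lift.
  let κ : C →* B := (((MulAut.conj c).toMonoidHom).comp C.subtype).codRestrict B hm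
  have hκ : κ ∈ (F.normalizerSystem hH).Hom C B :=
    (F.normalizerSystem hH).conj_mem (hzH.trans hT) (hyH.trans hT) c (hT hcH) _ fun _ => rfl
  have hκu : ∀ b, κ (u b) = b := fun b => Subtype.ext (by
    change c * (u b : G) * c⁻¹ = b
    rw [(hue b).1]; simp [mul_assoc])
  refine ⟨⟨C, (F.normalizerSystem hH).cls ⟨ψ.1.comp κ,
    (F.normalizerSystem hH).comp_mem ψ.2 hκ⟩⟩, ?_, ?_, ?_⟩
  · rw [compPair_cls]
    congr 1
    refine cls_eq_iff.2 ⟨⟨k, hk⟩, fun d => Subtype.ext ?_⟩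
    obtain ⟨b, rfl⟩ := hs d
    rw [(hue b).2]
    change _ = k * (γ.1 (ψ.1 (κ (u b))) : G) * k⁻¹
    rw [hκu]; rfl
  · refine pairLE_iff.2 ⟨c, hcH, 1, N.one_mem, fun b => ⟨u b, (hue b).1, ?_⟩⟩
    change (ψ.1 (κ (u b)) : G) = _
    rw [hκu]; simp
  · refine pairLE_iff.2 ⟨c⁻¹, H.inv_mem hcH, 1, N.one_mem, fun d => ⟨κ d, ?_, ?_⟩⟩
    · simp [κ]
    · simp

end Normalizer

end FusionSystem

end Fus

end

/-! ### The decomposition of `[H ×_F K]`. -/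

open Fus FusionSystem in
theorem mainTheorem2 {G : Type*} [Group G] (p : ℕ) [Fact p.Prime]
    (S : Subgroup G) [Finite S] (hS : IsPGroup p S)
    (F : FusionSystem S) (hF : F.IsSaturated p)
    (H : Subgroup G) (hH : H ≤ S) (hHn : F.IsFullyNormalized H) (hHc : F.IsCentric H)
    (K : Subgroup G) (hK : F.IsCentric K)
    (P : Set (F.Pair K)) (hP : F.IsProductReps hH K P)
    (Q : Set (F.Pair K)) (hQ : F.IsNormalizerReps hH P Q) :
    (∀ x ∈ Q, ∃! g : F.OrbHom (x.2.normBefore (F.normalizerSystem hH)) K, g.Extends x.2) ∧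
    ∀ ext : (x : Q) → F.OrbHom (x.1.2.normBefore (F.normalizerSystem hH)) K,
      (∀ x : Q, (ext x).Extends x.1.2) →
      ∃ R : (x : Q) → Set ((F.normalizerSystem hH).Pair
          (x.1.2.normBefore (F.normalizerSystem hH))),
        (∀ x : Q, (F.normalizerSystem hH).IsProductReps (le_inf_normalizer hH)
          (x.1.2.normBefore (F.normalizerSystem hH)) (R x)) ∧
        (∀ x : Q, Set.InjOn (compPair (ext x)) (R x)) ∧
        (Pairwise fun x y : Q =>
          Disjoint (compPair (ext x) '' R x) (compPair (ext y) '' R y)) ∧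
        P = ⋃ x : Q, compPair (ext x) '' R x := by
  obtain ⟨-, -, hPmax, hPrep⟩ := hP
  obtain ⟨hQP, hQtop, hQrep⟩ := hQ
  have hmax : ∀ x ∈ Q, F.IsMaximalPair hH K x := fun x hx => hPmax x (hQP hx)
  have hT := le_inf_normalizer hH
  refine ⟨fun x hx => hF.existsUnique_extends hS _ inf_le_left (hmax x hx).1.2
    ((hmax x hx).1.1.trans hT) x.2, fun ext hext => ?_⟩
  have hinj : ∀ x : Q, Set.InjOn (compPair (ext x))
      {y | (F.normalizerSystem hH).IsMaximalPair hT _ y ∧ compPair (ext x) y ∈ P} :=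
    fun x y hy z hz h => eq_of_compPair_eq (hmax x x.2) (hQtop x x.2).2 (hext x) hy.1 hz.1 h
  -- The choice dictated by the formula: all maximal pairs of `N_F(H)` whose image already belongs
  -- to `P`.
  refine ⟨fun x => {y | (F.normalizerSystem hH).IsMaximalPair hT _ y ∧ compPair (ext x) y ∈ P},
    fun x => ⟨isCentric_normalizerSystem hHc hT, ?_, fun y hy => hy.1, fun y hy => ?_⟩,
    hinj, fun x x' hxx' => ?_, ?_⟩
  · obtain ⟨hAN, -⟩ := hext x
    have hNT := x.1.2.normBefore_le (F.normalizerSystem hH)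
    exact isCentric_normalizerSystem ((hmax x x.2).1.2.mono hAN (ext x).source_le) hNT
  · obtain ⟨z, ⟨hzP, hyz, hzy⟩, hzu⟩ := hPrep _ ((hmax x x.2).map (hext x) hy).1
    obtain ⟨w, rfl, hyw, hwy⟩ := exists_compPair_eq (ext x) hy.1.1 (hPmax z hzP).1.1 hyz hzy
    refine ⟨w, ⟨⟨isMaximalPair_of_compPair _ (hPmax _ hzP), hzP⟩, hyw, hwy⟩, ?_⟩
    rintro v ⟨hv, hyv, hvy⟩
    exact hinj x hv ⟨isMaximalPair_of_compPair _ (hPmax _ hzP), hzP⟩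
      (hzu _ ⟨hv.2, hyv.map _, hvy.map _⟩)
  · refine Set.disjoint_left.2 ?_
    rintro _ ⟨y, hy, rfl⟩ ⟨z, hz, hzy⟩
    refine hxx' (Subtype.ext ((hQrep _ hy.2).unique
      ⟨x.2, ((hmax x x.2).map (hext x) hy.1).2⟩ ⟨x'.2, ?_⟩))
    rw [← hzy]
    exact ((hmax x' x'.2).map (hext x') hz.1).2
  · refine Set.Subset.antisymm (fun z hz => ?_) (Set.iUnion_subset fun x => ?_)
    · obtain ⟨x, ⟨hx, θ, -, hθ⟩, -⟩ := hQrep z hz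
      obtain ⟨hAN, hfg⟩ := hext ⟨x, hx⟩
      have hNT := x.2.normBefore_le (F.normalizerSystem hH)
      -- Since `z = f θ` and `f = f̂ ι` for the chosen extension `f̂` of `f = x.2`, the pair given
      -- by `ι θ` maps to `z`.
      have he : compPair (ext ⟨x, hx⟩) ⟨z.1, ((F.normalizerSystem hH).inclCls hAN hNT).comp
          ((F.normalizerSystem hH).cls θ)⟩ = z := by
        obtain ⟨C, f⟩ := z
        exact (compPair_inclCls_comp _ hAN hNT _).trans
          (congrArg (Sigma.mk C) ((congrArg (fun u : F.OrbHom x.1 K =>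
            u.comp (OrbHom.ofNormalizer ((F.normalizerSystem hH).cls θ))) hfg).trans hθ.symm))
      exact Set.mem_iUnion.2 ⟨⟨x, hx⟩, _,
        ⟨isMaximalPair_of_compPair _ (he.symm ▸ hPmax z hz), he.symm ▸ hz⟩, he⟩
    · rintro _ ⟨y, hy, rfl⟩
      exact hy.2
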